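/- **Setting.** For each index $j\in\mathbb N$ (suppressed in the notation below) let $\mathcal G$ be an undirected simple graph on $n$ nodes with maximum degree $d$ and oriented incidence matrix $F$ (the row of an edge $\{i,i'\}$, $i<i'$, has $-1$ in entry $i$, $+1$ in entry $i'$ and $0$ elsewhere). The graph difference operators are $\Delta^{(1)}=F$ and, for $k\ge 1$, $\Delta^{(k+1)}=F^T\Delta^{(k)}$ if $k$ is odd, $\Delta^{(k+1)}=F\Delta^{(k)}$ if $k$ is even. Consider the linear model $y=X\beta^*+\varepsilon$ with $X\in\mathbb R^{N\times n}$, where $\|\Delta^{(k+1)}\beta^*\|_0\le s_1$ and $\|\beta^*\|_0\le s_2$ for integers $s_1,s_2>0$, $\varepsilon\sim N(0,\sigma_\varepsilon^2I_N)$ with $\sigma_\varepsilon>0$ is independent of $X$, and the rows of $X$ are i.i.d. draws from a mean-zero distribution on $\mathbb R^n$ with covariance matrix $\Sigma_x$ such that $\mathbb E\exp(t\,u^TX_i)\le\exp(\sigma_x^2t^2/2)$ for all $t\in\mathbb R$ and all unit vectors $u$. The eigenvalues of $\Sigma_x$ lie in $[c,c']$ with $0<c\le c'$, and $\Theta_x=\Sigma_x^{-1}$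 satisfies $\max_i\sum_l|(\Theta_x)_{il}|\le M_n$. Below, $\|\cdot\|_\infty$ is the largest absolute entry of a vector or matrix. Put $\Sigma_N=X^TX/N$ and let $$\hat\beta\in\operatorname*{argmin}_{\beta\in\mathbb R^n}\ \tfrac1{2N}\|y-X\beta\|_2^2+\lambda_g\|\Delta^{(k+1)}\beta\|_1+\lambda\|\beta\|_1 .$$ Let $\widehat\Theta$ be a measurable function of $X$ that minimizes $\sum_{i,l}|\Theta_{il}|$ over all $\Theta\in\mathbb R^{n\times n}$ with $\|\Theta\Sigma_N-I_n\|_\infty\le\mu$ whenever this constraint is feasible (and is arbitrary otherwise), and let $\tilde\beta=\hat\beta+\frac1N\widehat\Theta X^T(y-X\hat\beta)$. **Theorem.** Fix $k\ge0$, $0\le\nu<1$, $\sigma_x>0$, $c>0$ and $c'>0$. There are constants $C_0,A,A'>0$, depending only on these, such that the following holds for all constants $B,B'$ and every sequence of such models (in which $N,n,\mathcal G,s_1,s_2,\beta^*,\Sigma_x,M_n,\sigma_\varepsilon$ and the laws may all vary) with $n\to\infty$, $N\ge C_0\,s_2\log n$, $s_2/s_1\ge\nu$, and tuning parameters $$A\,\sigma_\varepsilon\sqrt{\tfrac{\log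 n}N}\le\lambda\le B\,\sigma_\varepsilon\sqrt{\tfrac{\log n}N},\qquad \lambda_g=\lambda\sqrt{\tfrac{\nu}{(2d)^{k+1}}},\qquad A'\sqrt{\tfrac{\log n}N}\le\mu\le B'\sqrt{\tfrac{\log n}N}$$ (with $\lambda_g=0$ if the graph has no edges). We have $\sqrt N(\tilde\beta-\beta^*)=\Psi-e$ with $\Psi=\frac1{\sqrt N}\widehat\Theta X^T\varepsilon$ and $e=\sqrt N(\widehat\Theta\Sigma_N-I_n)(\hat\beta-\beta^*)$, where $$\Psi\mid X\sim N\bigl(0,\ \sigma_\varepsilon^2\,\widehat\Theta\Sigma_N\widehat\Theta^T\bigr),\qquad \|e\|_\infty=\mathcal O_{\mathbb P}\Bigl(\frac{\sigma_\varepsilon s_2\log n}{\sqrt N}\Bigr),$$ and $$\bigl\|\widehat\Theta\Sigma_N\widehat\Theta^T-\Theta_x\bigr\|_\infty=\mathcal O_{\mathbb P}\Bigl(M_n\sqrt{\tfrac{\log n}N}\Bigr).$$ -/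

import Mathlib

open MeasureTheory ProbabilityTheory Filter Matrix
open scoped Topology

namespace GraphPPLasso

/-! ### Matrix and vector norms -/

/-- The Borel (product) measurable structure on the space of real matrices. -/
instance instMeasurableSpaceMatrix {m n : Type*} : MeasurableSpace (Matrix m n ℝ) :=
  inferInstanceAs (MeasurableSpace (m → n → ℝ))

/-- Element-wise infinity norm `‖v‖_∞ = max_i |v_i|` of a vector (`0` if there are no entries). -/
noncomputable def vecSupNorm {ι : Type*} (v : ι → ℝ) : ℝ := ⨆ i, |v i|

/-- Element-wise infinity norm `‖A‖_∞ = max_{i,j} |A_ij|` of a matrix. -/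
noncomputable def matSupNorm {ι κ : Type*} (A : Matrix ι κ ℝ) : ℝ :=
  ⨆ p : ι × κ, |A p.1 p.2|

/-- The `ℓ_∞`-operator norm (maximal absolute row sum) of a matrix. -/
noncomputable def opNormInf {ι κ : Type*} [Fintype κ] (A : Matrix ι κ ℝ) : ℝ :=
  ⨆ i, ∑ j, |A i j|

/-- The element-wise `ℓ_1`-norm `‖A‖_{1,1}` of a matrix. -/
def norm11 {ι κ : Type*} [Fintype ι] [Fintype κ] (A : Matrix ι κ ℝ) : ℝ := ∑ i, ∑ j, |A i j|

/-- The `ℓ_1`-norm of a vector. -/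
def l1Norm {ι : Type*} [Fintype ι] (v : ι → ℝ) : ℝ := ∑ i, |v i|

/-- `‖v‖_0`: the number of non-zero entries of a vector. -/
noncomputable def l0Norm {ι : Type*} (v : ι → ℝ) : ℕ := Set.ncard {i | v i ≠ 0}

/-- All eigenvalues of the symmetric matrix `A` lie in `[lo, hi]`. -/
def SymmEigenvaluesIn {n : ℕ} (lo hi : ℝ) (A : Matrix (Fin n) (Fin n) ℝ) : Prop :=
  ∃ h : A.IsHermitian, ∀ i, lo ≤ h.eigenvalues i ∧ h.eigenvalues i ≤ hi

/-! ### Graph difference operators -/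

section Graph

variable {n : ℕ}

noncomputable instance instFintypeEdges (G : SimpleGraph (Fin n)) : Fintype G.edgeSet :=
  Fintype.ofFinite _

/-- The oriented incidence matrix, with rows indexed by the edges of the graph: the row of the
edge `{i, j}`, `i < j`, has `-1` in the entry `i` and `+1` in the entry `j`. -/
def incidence (G : SimpleGraph (Fin n)) : Matrix G.edgeSet (Fin n) ℝ :=
  Matrix.of fun e v => if v = (e : Sym2 (Fin n)).inf then -1
    else if v = (e : Sym2 (Fin n)).sup then 1 else 0

/-- The index set of the rows of the difference operator of order `k + 1`:
the edges if `k` is even, the nodes if `k` is odd. -/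
def DiffIndex (G : SimpleGraph (Fin n)) : ℕ → Type
  | 0 => G.edgeSet
  | 1 => Fin n
  | k + 2 => DiffIndex G k

noncomputable instance instFintypeDiffIndex (G : SimpleGraph (Fin n)) :
    (k : ℕ) → Fintype (DiffIndex G k)
  | 0 => inferInstanceAs (Fintype G.edgeSet)
  | 1 => inferInstanceAs (Fintype (Fin n))
  | k + 2 => instFintypeDiffIndex G k

/-- The left factor in the recursion from order `k + 1` to order `k + 2`:
`Fᵀ` if `k` is even, `F` if `k` is odd. -/
def diffStep (G : SimpleGraph (Fin n)) :
    (k : ℕ) → Matrix (DiffIndex G (k + 1)) (DiffIndex G k) ℝ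
  | 0 => (incidence G)ᵀ
  | 1 => incidence G
  | k + 2 => diffStep G k

/-- `diffOp G k` is the graph difference operator `Δ^{(k+1)}` of order `k + 1`:
`Δ^{(1)} = F`, and `Δ^{(k+1)} = Fᵀ Δ^{(k)}` for odd `k`, `Δ^{(k+1)} = F Δ^{(k)}` for even `k`. -/
noncomputable def diffOp (G : SimpleGraph (Fin n)) :
    (k : ℕ) → Matrix (DiffIndex G k) (Fin n) ℝ
  | 0 => incidence G
  | k + 1 => diffStep G k * diffOp G k

open Classical in
/-- The maximum degree of the graph. -/
noncomputable def maxDeg (G : SimpleGraph (Fin n)) : ℕ := G.maxDegree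

/-- The parameter space `S(k, s₁, s₂)`. -/
def paramSpace (G : SimpleGraph (Fin n)) (k s₁ s₂ : ℕ) : Set (Fin n → ℝ) :=
  {β | l0Norm (diffOp G k *ᵥ β) ≤ s₁ ∧ l0Norm β ≤ s₂}

end Graph

/-! ### Sub-Gaussian designs -/

/-- A real random variable is `σ`-sub-Gaussian: mean zero, and moment generating function
at most `exp (σ² t² / 2)` for every real `t`. -/
def IsSubGaussian {Ω : Type*} [MeasurableSpace Ω] (σ : ℝ) (Z : Ω → ℝ) (P : Measure Ω) : Prop :=
  ∫ ω, Z ω ∂P = 0 ∧ HasSubgaussianMGF Z ⟨σ ^ 2, sq_nonneg σ⟩ P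

/-- A distribution `Q` on `ℝⁿ` is `σ`-sub-Gaussian: mean zero, and each projection on a unit
vector is `σ`-sub-Gaussian. -/
def IsSubGaussianLaw {n : ℕ} (σ : ℝ) (Q : Measure (Fin n → ℝ)) : Prop :=
  (∀ a, ∫ x, x a ∂Q = 0) ∧
    ∀ u : Fin n → ℝ, u ⬝ᵥ u = 1 → IsSubGaussian σ (fun x => u ⬝ᵥ x) Q

/-- `X` is a row-wise `(σ, S)`-sub-Gaussian random matrix: its rows are i.i.d. draws from a
`σ`-sub-Gaussian distribution with covariance matrix `S`. -/
def IsRowwiseSubGaussian {Ω : Type*} [MeasurableSpace Ω] {N n : ℕ} (P : Measure Ω)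
    (X : Ω → Matrix (Fin N) (Fin n) ℝ) (σ : ℝ) (S : Matrix (Fin n) (Fin n) ℝ) : Prop :=
  ∃ Q : Measure (Fin n → ℝ), IsProbabilityMeasure Q ∧ IsSubGaussianLaw σ Q ∧
    (∀ a b, cov[fun x => x a, fun x => x b; Q] = S a b) ∧
    (∀ i, HasLaw (fun ω => X ω i) Q P) ∧
    iIndepFun (fun i ω => X ω i) P

/-! ### The estimators -/

section Estimators

variable {N n : ℕ}

/-- `Σ_N = Xᵀ X / N`. -/
noncomputable def sampleCov (X : Matrix (Fin N) (Fin n) ℝ) : Matrix (Fin n) (Fin n) ℝ :=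
  (1 / (N : ℝ)) • (Xᵀ * X)

/-- The objective function of the `k`-th order Graph-Piecewise-Polynomial-Lasso. -/
noncomputable def gpplObjective (G : SimpleGraph (Fin n)) (k : ℕ) (lam lamg : ℝ)
    (X : Matrix (Fin N) (Fin n) ℝ) (y : Fin N → ℝ) (β : Fin n → ℝ) : ℝ :=
  1 / (2 * (N : ℝ)) * ∑ i, (y i - (X *ᵥ β) i) ^ 2 + lamg * l1Norm (diffOp G k *ᵥ β)
    + lam * l1Norm β

/-- `β` is a `k`-th order Graph-Piecewise-Polynomial-Lasso estimate for the data `(X, y)`. -/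
def IsGPPLasso (G : SimpleGraph (Fin n)) (k : ℕ) (lam lamg : ℝ)
    (X : Matrix (Fin N) (Fin n) ℝ) (y : Fin N → ℝ) (β : Fin n → ℝ) : Prop :=
  ∀ β', gpplObjective G k lam lamg X y β ≤ gpplObjective G k lam lamg X y β'

/-- `Θ` satisfies the constraint `‖Θ S - I‖_∞ ≤ μ`. -/
def CLIMEFeasible (μ : ℝ) (S Θ : Matrix (Fin n) (Fin n) ℝ) : Prop :=
  matSupNorm (Θ * S - 1) ≤ μ

/-- `Θ` minimizes `‖Θ‖_{1,1}` subject to `‖Θ S - I‖_∞ ≤ μ`. -/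
def IsCLIME (μ : ℝ) (S Θ : Matrix (Fin n) (Fin n) ℝ) : Prop :=
  CLIMEFeasible μ S Θ ∧ ∀ Θ', CLIMEFeasible μ S Θ' → norm11 Θ ≤ norm11 Θ'

/-- `T` is a CLIME estimator with tuning parameter `μ`: a Borel function of the design matrix
whose value is a solution of the CLIME program for `Σ_N` at every design for which the program
has a feasible point (at the other designs, where there is no solution, the value is arbitrary). -/
def IsCLIMEEstimator (μ : ℝ)
    (T : Matrix (Fin N) (Fin n) ℝ → Matrix (Fin n) (Fin n) ℝ) : Prop :=
  Measurable T ∧ ∀ A, (∃ Θ, CLIMEFeasible μ (sampleCov A) Θ) → IsCLIME μ (sampleCov A) (T A)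

/-- The one-step estimator `β̂ + Θ̂ Xᵀ (y - X β̂) / N`. -/
noncomputable def oneStep (X : Matrix (Fin N) (Fin n) ℝ) (y : Fin N → ℝ)
    (Θ : Matrix (Fin n) (Fin n) ℝ) (β : Fin n → ℝ) : Fin n → ℝ :=
  β + (1 / (N : ℝ)) • ((Θ * Xᵀ) *ᵥ (y - X *ᵥ β))

/-- The leading term `Ψ = Θ̂ Xᵀ ε / √N`. -/
noncomputable def leadingTerm (X : Matrix (Fin N) (Fin n) ℝ) (Θ : Matrix (Fin n) (Fin n) ℝ)
    (ε : Fin N → ℝ) : Fin n → ℝ :=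
  (1 / √(N : ℝ)) • ((Θ * Xᵀ) *ᵥ ε)

/-- The remainder `e = √N (Θ̂ Σ_N - I) (β̂ - β*)`. -/
noncomputable def remainderTerm (X : Matrix (Fin N) (Fin n) ℝ) (Θ : Matrix (Fin n) (Fin n) ℝ)
    (β βstar : Fin n → ℝ) : Fin n → ℝ :=
  √(N : ℝ) • ((Θ * sampleCov X - 1) *ᵥ (β - βstar))

end Estimators

/-! ### Stochastic boundedness -/

/-- `Y_j = O_P(a_j)` as `j → ∞`, where `Y_j` lives on the probability space `(Ω_j, P_j)`. -/
def IsBigOInProb {Ω : ℕ → Type*} [∀ j, MeasurableSpace (Ω j)] (P : ∀ j, Measure (Ω j))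
    (Y : ∀ j, Ω j → ℝ) (a : ℕ → ℝ) : Prop :=
  ∀ δ : ℝ, 0 < δ → ∃ K : ℝ, 0 < K ∧
    ∀ᶠ j in atTop, P j {ω | K * a j < |Y j ω|} ≤ ENNReal.ofReal δ

end GraphPPLasso

namespace GraphPPLasso

/-! ### Norm inequalities -/

section Norms

variable {ι κ : Type*}

/-! Both rates are deterministic consequences of one event, `GoodEvent`, whose complement has
probability at most `8 / n` once `n ≥ 2` (`measure_not_goodEvent_le`). The decomposition itself is
algebra, and `Ψ` is conditionally Gaussian because `Θ̂` is a function of `X`: with `X` frozen, `Ψ`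
is a linear image of the noise (`condDistrib_leadingTerm`).

Remainder. The CLIME constraint gives `‖e‖_∞ ≤ √N μ ‖β̂ - β*‖₁`, so an `ℓ₁` error of order `s₂ λ` is
enough. The weight `λ_g` is tuned so that the graph penalty costs no more than a multiple of the
sparsity penalty (`lamg_mul_le`); the usual Lasso comparison then puts the error in the cone `‖v‖₁ ≤
6 √s₂ ‖v‖₂`, where a restricted eigenvalue bound concludes (`gppLasso_l1_error`). That bound comes
from Maurey's averaging: a quadratic form that is non-negative on all sums of `m + 1` signed
coordinate vectors is non-negative everywhere up to a loss `D ‖v‖₁² / m` (`quadForm_lower_bound`).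
With length of order `s₂` the loss is harmless on the cone, and only `(2n)^O(s₂)` vectors need a
union bound, which is why `N ≥ C₀ s₂ log n` suffices.

Covariance. On the event `Σ_x⁻¹` is itself feasible. CLIME separates over rows, so the rows of `Θ̂`
have `ℓ₁` norm at most `M_n`, and the error splits into three products of size at most `M_n μ`
(`IsCLIME.matSupNorm_sub_le`).

The design events all follow from one Bernstein inequality for `uᵀ (Σ_N - Σ_x) v`
(`measure_lt_abs_le`), the noise event from a Gaussian tail conditional on the design. -/

lemma vecSupNorm_nonneg (v : ι → ℝ) : 0 ≤ vecSupNorm v :=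
  Real.iSup_nonneg fun _ => abs_nonneg _

lemma matSupNorm_nonneg (A : Matrix ι κ ℝ) : 0 ≤ matSupNorm A :=
  Real.iSup_nonneg fun _ => abs_nonneg _

lemma vecSupNorm_le {v : ι → ℝ} {C : ℝ} (hC : 0 ≤ C) (h : ∀ i, |v i| ≤ C) : vecSupNorm v ≤ C :=
  Real.iSup_le h hC

lemma matSupNorm_le {A : Matrix ι κ ℝ} {C : ℝ} (hC : 0 ≤ C) (h : ∀ i j, |A i j| ≤ C) :
    matSupNorm A ≤ C :=
  Real.iSup_le (fun p => h p.1 p.2) hC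

lemma abs_le_matSupNorm [Finite ι] [Finite κ] (A : Matrix ι κ ℝ) (i : ι) (j : κ) :
    |A i j| ≤ matSupNorm A :=
  le_ciSup (f := fun p : ι × κ => |A p.1 p.2|) (Set.finite_range _).bddAbove (i, j)

lemma l1Norm_row_le_opNormInf [Finite ι] [Fintype κ] (A : Matrix ι κ ℝ) (i : ι) :
    l1Norm (A i) ≤ opNormInf A :=
  le_ciSup (f := fun i => ∑ j, |A i j|) (Set.finite_range _).bddAbove i

lemma l1Norm_nonneg [Fintype ι] (v : ι → ℝ) : 0 ≤ l1Norm v :=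
  Finset.sum_nonneg fun _ _ => abs_nonneg _

lemma abs_dotProduct_le [Fintype ι] {v w : ι → ℝ} {a : ℝ} (h : ∀ i, |v i| ≤ a) :
    |v ⬝ᵥ w| ≤ a * l1Norm w := by
  unfold dotProduct l1Norm
  rw [Finset.mul_sum]
  refine (Finset.abs_sum_le_sum_abs _ _).trans (Finset.sum_le_sum fun i _ => ?_)
  rw [abs_mul]
  exact mul_le_mul_of_nonneg_right (h i) (abs_nonneg _)

lemma dotProduct_self_nonneg' [Fintype ι] (v : ι → ℝ) : 0 ≤ v ⬝ᵥ v :=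
  Finset.sum_nonneg fun _ _ => mul_self_nonneg _

lemma sq_dotProduct_le [Fintype ι] (v w : ι → ℝ) : (v ⬝ᵥ w) ^ 2 ≤ (v ⬝ᵥ v) * (w ⬝ᵥ w) := by
  have := Finset.sum_mul_sq_le_sq_mul_sq Finset.univ v w
  simpa [dotProduct, sq] using this

-- Holds coordinatewise: off the support of `a` it is an equality, and on the support it is the
-- triangle inequality.
open Classical in
lemma l1Norm_sub_le_support [Fintype ι] (a b : ι → ℝ) :
    l1Norm a - l1Norm b ≤ 2 * (∑ i with a i ≠ 0, |b i - a i|) - l1Norm (b - a) := by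
  unfold l1Norm
  rw [Finset.sum_filter, Finset.mul_sum, ← Finset.sum_sub_distrib, ← Finset.sum_sub_distrib]
  refine Finset.sum_le_sum fun i _ => ?_
  by_cases h : a i = 0
  · simp [h]
  · simp only [ne_eq, h, not_false_eq_true, if_true, Pi.sub_apply]
    have := abs_sub_abs_le_abs_sub (a i) (b i)
    rw [abs_sub_comm] at this
    linarith

open Classical in
lemma sum_support_abs_le [Fintype ι] (a d : ι → ℝ) :
    ∑ i with a i ≠ 0, |d i| ≤ √(l0Norm a) * √(d ⬝ᵥ d) := by
  rw [← Real.sqrt_mul (by positivity)]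
  refine Real.le_sqrt_of_sq_le ?_
  have h1 := sq_sum_le_card_mul_sum_sq (s := Finset.univ.filter fun i => a i ≠ 0)
    (f := fun i => |d i|)
  have h2 : l0Norm a = (Finset.univ.filter fun i => a i ≠ 0).card := by
    unfold l0Norm
    rw [← Set.ncard_coe_finset]
    congr 1
    ext i
    simp
  rw [h2]
  refine h1.trans (mul_le_mul_of_nonneg_left ?_ (by positivity))
  simp only [sq_abs, dotProduct, ← sq]
  exact Finset.sum_le_sum_of_subset_of_nonneg (Finset.filter_subset _ _)
    fun i _ _ => sq_nonneg _

lemma l1Norm_sub_le [Fintype ι] (a b : ι → ℝ) :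
    l1Norm a - l1Norm b ≤ 2 * (√(l0Norm a) * √((b - a) ⬝ᵥ (b - a))) - l1Norm (b - a) := by
  have h1 := l1Norm_sub_le_support a b
  have h2 := sum_support_abs_le a (b - a)
  simp only [Pi.sub_apply] at h2
  linarith

/-- Trades the negative `ℓ₁` term of `l1Norm_sub_le` for the constant 1. This form serves the graph
penalty, where only the Euclidean size of the difference is of use. -/
lemma l1Norm_sub_le' [Fintype ι] (a b : ι → ℝ) :
    l1Norm a - l1Norm b ≤ √(l0Norm a) * √((b - a) ⬝ᵥ (b - a)) := by
  classical
  have h1 := l1Norm_sub_le_support a b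
  have h2 := sum_support_abs_le a (b - a)
  have h3 : ∑ i with a i ≠ 0, |b i - a i| ≤ l1Norm (b - a) :=
    Finset.sum_le_sum_of_subset_of_nonneg (Finset.filter_subset _ _) fun i _ _ => abs_nonneg _
  simp only [Pi.sub_apply] at h2
  linarith

/-- A matrix and its transpose have the same operator norm: for `x = Aᵀ w`, Cauchy–Schwarz on `‖x‖²
= ⟨w, A x⟩` gives `‖x‖⁴ ≤ c ‖w‖² ‖x‖²`, and one divides by `‖x‖²`. -/
lemma dotProduct_transpose_mulVec_le [Fintype ι] [Fintype κ] {A : Matrix ι κ ℝ} {c : ℝ}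
    (hc : 0 ≤ c) (h : ∀ v, (A *ᵥ v) ⬝ᵥ (A *ᵥ v) ≤ c * (v ⬝ᵥ v)) (w : ι → ℝ) :
    (Aᵀ *ᵥ w) ⬝ᵥ (Aᵀ *ᵥ w) ≤ c * (w ⬝ᵥ w) := by
  set x := Aᵀ *ᵥ w with hx
  have h1 : x ⬝ᵥ x = w ⬝ᵥ (A *ᵥ x) := by
    rw [Matrix.dotProduct_mulVec, ← Matrix.mulVec_transpose,
      Matrix.transpose_transpose, dotProduct_comm]
  have h2 := sq_dotProduct_le w (A *ᵥ x)
  rw [← h1] at h2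
  have h3 := mul_le_mul_of_nonneg_left (h x) (dotProduct_self_nonneg' w)
  rcases (dotProduct_self_nonneg' x).eq_or_lt with h0 | h0
  · rw [← h0]; exact mul_nonneg hc (dotProduct_self_nonneg' w)
  · nlinarith

end Norms

/-! ### Operator norms of graph difference operators -/

section Graph

variable {n : ℕ}

lemma incidence_mulVec (G : SimpleGraph (Fin n)) (v : Fin n → ℝ) (e : G.edgeSet) :
    (incidence G *ᵥ v) e = v (e : Sym2 (Fin n)).sup - v (e : Sym2 (Fin n)).inf := by
  have hne : (e : Sym2 (Fin n)).inf ≠ (e : Sym2 (Fin n)).sup := by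
    obtain ⟨e, he⟩ := e
    induction e using Sym2.ind with
    | _ a b =>
      have hab : a ≠ b := G.ne_of_adj (by simpa using he)
      simpa using hab
  have h : ∀ x, incidence G e x * v x = (if x = (e : Sym2 (Fin n)).sup then v x else 0)
      - (if x = (e : Sym2 (Fin n)).inf then v x else 0) := by
    intro x
    simp only [incidence, Matrix.of_apply]
    by_cases h1 : x = (e : Sym2 (Fin n)).inf
    · have h2 : x ≠ (e : Sym2 (Fin n)).sup := h1 ▸ hne
      simp [h1, hne]
    · by_cases h2 : x = (e : Sym2 (Fin n)).sup <;> simp [h1, h2, hne.symm]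
  simp only [Matrix.mulVec, dotProduct, h, Finset.sum_sub_distrib]
  simp

/-- Each edge contributes `(v_a - v_b)² ≤ 2 (v_a² + v_b²)`, and a node lies on at most `d` edges. -/
lemma dotProduct_incidence_mulVec_le (G : SimpleGraph (Fin n)) (v : Fin n → ℝ) :
    (incidence G *ᵥ v) ⬝ᵥ (incidence G *ᵥ v) ≤ 2 * (maxDeg G : ℝ) * (v ⬝ᵥ v) := by
  classical
  have hterm : ∀ e : G.edgeSet, (incidence G *ᵥ v) e * (incidence G *ᵥ v) e
      ≤ 2 * ∑ i, if i ∈ (e : Sym2 (Fin n)) then v i ^ 2 else 0 := by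
    intro e
    rw [incidence_mulVec]
    obtain ⟨e, he⟩ := e
    induction e using Sym2.ind with
    | _ a b =>
      have hab : a ≠ b := G.ne_of_adj (by simpa using he)
      have hs : ∑ i, (if i ∈ s(a, b) then v i ^ 2 else 0) = v a ^ 2 + v b ^ 2 := by
        rw [← Finset.sum_filter]
        have : (Finset.univ.filter fun i => i ∈ s(a, b)) = {a, b} := by
          ext i; simp
        rw [this, Finset.sum_pair hab]
      rw [hs]
      simp only [Sym2.sup_mk, Sym2.inf_mk]
      rcases le_total a b with h | h
      · simp only [h, sup_of_le_right, inf_of_le_left]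
        nlinarith [sq_nonneg (v a + v b)]
      · simp only [h, sup_of_le_left, inf_of_le_right]
        nlinarith [sq_nonneg (v a + v b)]
  have hdeg : ∀ i, (∑ e : G.edgeSet, if i ∈ (e : Sym2 (Fin n)) then v i ^ 2 else 0)
      ≤ (maxDeg G : ℝ) * v i ^ 2 := by
    intro i
    rw [← Finset.sum_filter, Finset.sum_const, nsmul_eq_mul]
    refine mul_le_mul_of_nonneg_right ?_ (sq_nonneg _)
    have h1 : (Finset.univ.filter fun e : G.edgeSet => i ∈ (e : Sym2 (Fin n))).card
        ≤ G.degree i := by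
      rw [← SimpleGraph.card_incidenceFinset_eq_degree]
      refine Finset.card_le_card_of_injOn (fun e => (e : Sym2 (Fin n))) ?_
        (fun x _ y _ h => Subtype.ext h)
      intro e he
      simp only [Finset.coe_filter, Finset.mem_univ, true_and, Set.mem_ofPred_eq] at he
      simp only [SimpleGraph.coe_incidenceFinset]
      exact ⟨e.2, he⟩
    have h2 : G.degree i ≤ maxDeg G := by
      unfold maxDeg
      convert G.degree_le_maxDegree i
    exact_mod_cast h1.trans h2
  calc (incidence G *ᵥ v) ⬝ᵥ (incidence G *ᵥ v)
      ≤ ∑ e : G.edgeSet, 2 * ∑ i, (if i ∈ (e : Sym2 (Fin n)) then v i ^ 2 else 0) :=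
        Finset.sum_le_sum fun e _ => hterm e
    _ = 2 * ∑ i, ∑ e : G.edgeSet, (if i ∈ (e : Sym2 (Fin n)) then v i ^ 2 else 0) := by
        rw [← Finset.mul_sum, Finset.sum_comm]
    _ ≤ 2 * ∑ i, (maxDeg G : ℝ) * v i ^ 2 := by
        gcongr with i
        exact hdeg i
    _ = 2 * (maxDeg G : ℝ) * (v ⬝ᵥ v) := by
        rw [← Finset.mul_sum, mul_assoc]
        simp [dotProduct, sq]

lemma dotProduct_diffStep_mulVec_le (G : SimpleGraph (Fin n)) : ∀ (k : ℕ)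
    (v : DiffIndex G k → ℝ),
    (diffStep G k *ᵥ v) ⬝ᵥ (diffStep G k *ᵥ v) ≤ 2 * (maxDeg G : ℝ) * (v ⬝ᵥ v)
  | 0, v => dotProduct_transpose_mulVec_le (by positivity) (dotProduct_incidence_mulVec_le G) v
  | 1, v => dotProduct_incidence_mulVec_le G v
  | k + 2, v => dotProduct_diffStep_mulVec_le G k v

lemma dotProduct_diffOp_mulVec_le (G : SimpleGraph (Fin n)) (k : ℕ) (v : Fin n → ℝ) :
    (diffOp G k *ᵥ v) ⬝ᵥ (diffOp G k *ᵥ v) ≤ (2 * (maxDeg G : ℝ)) ^ (k + 1) * (v ⬝ᵥ v) := by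
  induction k with
  | zero =>
    rw [zero_add, pow_one]
    exact dotProduct_incidence_mulVec_le G v
  | succ k ih =>
    have h : diffOp G (k + 1) *ᵥ v = diffStep G k *ᵥ (diffOp G k *ᵥ v) := by
      rw [diffOp, Matrix.mulVec_mulVec]
    rw [h]
    refine (dotProduct_diffStep_mulVec_le G k _).trans ?_
    rw [pow_succ' _ (k + 1), mul_assoc (2 * (maxDeg G : ℝ))]
    exact mul_le_mul_of_nonneg_left ih (by positivity)

end Graph

/-! ### The error of the penalised least squares estimate -/

section Lasso

variable {N n : ℕ}

lemma dotProduct_sampleCov_mulVec (X : Matrix (Fin N) (Fin n) ℝ) (u v : Fin n → ℝ) :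
    u ⬝ᵥ (sampleCov X *ᵥ v) = 1 / (N : ℝ) * ((X *ᵥ u) ⬝ᵥ (X *ᵥ v)) := by
  rw [sampleCov, Matrix.smul_mulVec, dotProduct_smul, smul_eq_mul, ← Matrix.mulVec_mulVec,
    Matrix.dotProduct_mulVec, Matrix.vecMul_transpose]

lemma sampleCov_isSymm (X : Matrix (Fin N) (Fin n) ℝ) : (sampleCov X)ᵀ = sampleCov X := by
  simp [sampleCov, Matrix.transpose_smul, Matrix.transpose_mul]

/-- The factor `(2d)^(k+1)` in the tuning cancels the squared operator norm of the difference
operator, and `ν s₁ ≤ s₂` exchanges the two sparsity levels. -/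
lemma lamg_mul_le {G : SimpleGraph (Fin n)} {k s₁ s₂ : ℕ} {ν lam lamg : ℝ} (hν : 0 ≤ ν)
    (hlam : 0 ≤ lam)
    (hlamg : lamg = lam * √(ν / (2 * (maxDeg G : ℝ)) ^ (k + 1)))
    (hs₁ : 0 < s₁) (hνs : ν ≤ (s₂ : ℝ) / s₁) {β b : Fin n → ℝ}
    (hβ : β ∈ paramSpace G k s₁ s₂) :
    lamg * (l1Norm (diffOp G k *ᵥ β) - l1Norm (diffOp G k *ᵥ b)) ≤
      lam * (√s₂ * √((b - β) ⬝ᵥ (b - β))) := by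
  set D : ℝ := (2 * (maxDeg G : ℝ)) ^ (k + 1) with hD
  have hD0 : 0 ≤ D := by positivity
  set q := (b - β) ⬝ᵥ (b - β) with hq
  have hq0 : 0 ≤ q := dotProduct_self_nonneg' _
  have hs : ν * s₁ ≤ s₂ := by
    rwa [le_div_iff₀ (by exact_mod_cast hs₁)] at hνs
  have h1 := l1Norm_sub_le' (diffOp G k *ᵥ β) (diffOp G k *ᵥ b)
  rw [← Matrix.mulVec_sub] at h1
  have h2 : √(l0Norm (diffOp G k *ᵥ β)) *
      √((diffOp G k *ᵥ (b - β)) ⬝ᵥ (diffOp G k *ᵥ (b - β))) ≤ √s₁ * √(D * q) := by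
    gcongr
    · exact_mod_cast hβ.1
    · exact dotProduct_diffOp_mulVec_le G k _
  have h3 : √(ν / D) * (√s₁ * √(D * q)) ≤ √s₂ * √q := by
    rw [← Real.sqrt_mul (by positivity), ← Real.sqrt_mul (by positivity),
      ← Real.sqrt_mul (by positivity)]
    apply Real.sqrt_le_sqrt
    -- Only an inequality, because an edgeless graph has `D = 0`, where division by zero makes the
    -- graph weight vanish.
    have : ν / D * D ≤ ν := by
      rcases hD0.eq_or_lt with h0 | h0
      · simpa [← h0] using hν
      · rw [div_mul_cancel₀ _ h0.ne']
    calc ν / D * (s₁ * (D * q)) = (ν / D * D) * s₁ * q := by ring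
      _ ≤ ν * s₁ * q := by gcongr
      _ ≤ s₂ * q := by gcongr
  rw [hlamg, mul_assoc]
  refine mul_le_mul_of_nonneg_left ?_ hlam
  exact (mul_le_mul_of_nonneg_left (h1.trans h2) (Real.sqrt_nonneg _)).trans h3

/-- Compare the objective at `b` and at `β`, with `L = ‖b - β‖₁` and `R = √s₂ ‖b - β‖₂`. The noise
costs `lam L / 2`, the graph penalty `lam R`, the sparsity penalty `lam (2 R - L)`; doubling the
outcome produces the 6. -/
lemma gppLasso_basic_inequality {G : SimpleGraph (Fin n)} {k s₁ s₂ : ℕ} {ν lam lamg : ℝ}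
    (hν : 0 ≤ ν) (hlam : 0 ≤ lam)
    (hlamg : lamg = lam * √(ν / (2 * (maxDeg G : ℝ)) ^ (k + 1)))
    (hs₁ : 0 < s₁) (hνs : ν ≤ (s₂ : ℝ) / s₁) {X : Matrix (Fin N) (Fin n) ℝ}
    {ε : Fin N → ℝ} {β b : Fin n → ℝ} (hN : 0 < N)
    (hβ : β ∈ paramSpace G k s₁ s₂)
    (hopt : IsGPPLasso G k lam lamg X (X *ᵥ β + ε) b)
    (hnoise : ∀ l, |(Xᵀ *ᵥ ε) l| ≤ N * (lam / 2)) :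
    (b - β) ⬝ᵥ (sampleCov X *ᵥ (b - β)) + lam * l1Norm (b - β) ≤
      6 * lam * (√s₂ * √((b - β) ⬝ᵥ (b - β))) := by
  have hN' : (0 : ℝ) < N := by exact_mod_cast hN
  have h0 := hopt β
  unfold gpplObjective at h0
  have e1 : ∑ i, ((X *ᵥ β + ε) i - (X *ᵥ β) i) ^ 2 = ε ⬝ᵥ ε := by
    simp [dotProduct, sq]
  have e2 : ∑ i, ((X *ᵥ β + ε) i - (X *ᵥ b) i) ^ 2 = ε ⬝ᵥ ε
      - 2 * ((Xᵀ *ᵥ ε) ⬝ᵥ (b - β)) + (X *ᵥ (b - β)) ⬝ᵥ (X *ᵥ (b - β)) := by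
    have : (Xᵀ *ᵥ ε) ⬝ᵥ (b - β) = ε ⬝ᵥ (X *ᵥ (b - β)) := by
      rw [Matrix.mulVec_transpose, Matrix.dotProduct_mulVec]
    rw [this, Matrix.mulVec_sub]
    simp only [dotProduct, Finset.mul_sum, ← Finset.sum_sub_distrib, ← Finset.sum_add_distrib]
    refine Finset.sum_congr rfl fun i _ => ?_
    simp only [Pi.add_apply, Pi.sub_apply]
    ring
  rw [e1, e2] at h0
  have h1 : (Xᵀ *ᵥ ε) ⬝ᵥ (b - β) ≤ N * (lam / 2) * l1Norm (b - β) :=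
    (le_abs_self _).trans (abs_dotProduct_le hnoise)
  have h2 := lamg_mul_le (b := b) hν hlam hlamg hs₁ hνs hβ
  have h3 := l1Norm_sub_le β b
  have h4 : √(l0Norm β) * √((b - β) ⬝ᵥ (b - β)) ≤ √s₂ * √((b - β) ⬝ᵥ (b - β)) := by
    gcongr
    exact_mod_cast hβ.2
  have h5 := mul_le_mul_of_nonneg_left h3 hlam
  have h6 := mul_le_mul_of_nonneg_left h4 hlam
  rw [dotProduct_sampleCov_mulVec]
  set Q := (X *ᵥ (b - β)) ⬝ᵥ (X *ᵥ (b - β))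
  set R := √s₂ * √((b - β) ⬝ᵥ (b - β))
  set Z := (Xᵀ *ᵥ ε) ⬝ᵥ (b - β)
  have h7 : 1 / (2 * (N : ℝ)) * (2 * Z) ≤ lam / 2 * l1Norm (b - β) := by
    calc 1 / (2 * (N : ℝ)) * (2 * Z) = Z / N := by field_simp
      _ ≤ _ := by
        rw [div_le_iff₀ hN']
        linarith
  have h8 : 1 / (N : ℝ) * Q = 2 * (1 / (2 * (N : ℝ)) * Q) := by field_simp
  rw [h8]
  nlinarith

/-- The basic inequality is used twice: without its quadratic form it gives the cone condition,
without its `ℓ₁` term it bounds `κ ‖b - β‖₂` by `6 lam √s₂`. The constant is `6 · 6`. -/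
lemma gppLasso_l1_error {G : SimpleGraph (Fin n)} {k s₁ s₂ : ℕ} {ν lam lamg κ : ℝ}
    (hν : 0 ≤ ν) (hlam : 0 < lam) (hκ : 0 < κ)
    (hlamg : lamg = lam * √(ν / (2 * (maxDeg G : ℝ)) ^ (k + 1)))
    (hs₁ : 0 < s₁) (hνs : ν ≤ (s₂ : ℝ) / s₁) {X : Matrix (Fin N) (Fin n) ℝ}
    {ε : Fin N → ℝ} {β b : Fin n → ℝ} (hN : 0 < N)
    (hβ : β ∈ paramSpace G k s₁ s₂)
    (hopt : IsGPPLasso G k lam lamg X (X *ᵥ β + ε) b)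
    (hnoise : ∀ l, |(Xᵀ *ᵥ ε) l| ≤ N * (lam / 2))
    (hRE : ∀ v : Fin n → ℝ, l1Norm v ^ 2 ≤ 36 * s₂ * (v ⬝ᵥ v) →
      κ * (v ⬝ᵥ v) ≤ v ⬝ᵥ (sampleCov X *ᵥ v)) :
    l1Norm (b - β) ≤ 36 / κ * s₂ * lam := by
  have h := gppLasso_basic_inequality hν hlam.le hlamg hs₁ hνs hN hβ hopt hnoise
  set q := (b - β) ⬝ᵥ (b - β) with hq
  have hq0 : 0 ≤ q := dotProduct_self_nonneg' _
  have hpsd : 0 ≤ (b - β) ⬝ᵥ (sampleCov X *ᵥ (b - β)) := by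
    rw [dotProduct_sampleCov_mulVec]
    exact mul_nonneg (by positivity) (dotProduct_self_nonneg' _)
  have hl := l1Norm_nonneg (b - β)
  have h1 : l1Norm (b - β) ≤ 6 * (√s₂ * √q) := by
    have : lam * l1Norm (b - β) ≤ lam * (6 * (√s₂ * √q)) := by linarith
    exact le_of_mul_le_mul_left this hlam
  have hss : √(s₂ : ℝ) * √(s₂ : ℝ) = s₂ := Real.mul_self_sqrt (by positivity)
  have hqq : √q * √q = q := Real.mul_self_sqrt hq0
  have h2 : l1Norm (b - β) ^ 2 ≤ 36 * s₂ * q := by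
    calc l1Norm (b - β) ^ 2 ≤ (6 * (√s₂ * √q)) ^ 2 := by gcongr
      _ = 36 * (√s₂ * √s₂) * (√q * √q) := by ring
      _ = _ := by rw [hss, hqq]
  have h3 := hRE _ h2
  rw [← hq] at h3
  have h4 : κ * √q ≤ 6 * lam * √s₂ := by
    rcases (Real.sqrt_nonneg q).eq_or_lt with h0 | h0
    · rw [← h0]; simp; positivity
    · have : √q * (κ * √q) ≤ √q * (6 * lam * √s₂) := by
        have := mul_nonneg hlam.le hl
        calc √q * (κ * √q) = κ * (√q * √q) := by ring
          _ = κ * q := by rw [hqq]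
          _ ≤ 6 * lam * (√s₂ * √q) := by linarith
          _ = _ := by ring
      exact le_of_mul_le_mul_left this h0
  have h5 : κ * l1Norm (b - β) ≤ 36 * s₂ * lam := by
    calc κ * l1Norm (b - β) ≤ κ * (6 * (√s₂ * √q)) := by gcongr
      _ = 6 * √s₂ * (κ * √q) := by ring
      _ ≤ 6 * √s₂ * (6 * lam * √s₂) := by gcongr
      _ = 36 * (√s₂ * √s₂) * lam := by ring
      _ = _ := by rw [hss]
  rw [show 36 / κ * s₂ * lam = (36 * s₂ * lam) / κ by ring, le_div_iff₀ hκ]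
  linarith

end Lasso

/-! ### Deterministic properties of CLIME solutions -/

section CLIME

variable {N n : ℕ}

/-- Constraint and objective both separate over rows, so exchanging a single row for that of a
feasible matrix keeps feasibility and cannot lower the objective. -/
lemma IsCLIME.l1Norm_row_le {μ : ℝ} {Γ Θ Θ₀ : Matrix (Fin n) (Fin n) ℝ} (h : IsCLIME μ Γ Θ)
    (h₀ : CLIMEFeasible μ Γ Θ₀) (i : Fin n) : l1Norm (Θ i) ≤ l1Norm (Θ₀ i) := by
  have hμ : 0 ≤ μ := (matSupNorm_nonneg _).trans h₀
  set Θ' := Θ.updateRow i (Θ₀ i) with hΘ'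
  have hi : Θ' i = Θ₀ i := by simp [hΘ']
  have hr : ∀ r, r ≠ i → Θ' r = Θ r := fun r hr => by simp [hΘ', hr]
  have hfeas : CLIMEFeasible μ Γ Θ' := by
    refine matSupNorm_le hμ fun r l => ?_
    by_cases hri : r = i
    · subst hri
      have : (Θ' * Γ - 1) r l = (Θ₀ * Γ - 1) r l := by
        simp only [Matrix.sub_apply, Matrix.mul_apply, hi]
      rw [this]
      exact (abs_le_matSupNorm _ _ _).trans h₀
    · have : (Θ' * Γ - 1) r l = (Θ * Γ - 1) r l := by
        simp only [Matrix.sub_apply, Matrix.mul_apply, hr r hri]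
      rw [this]
      exact (abs_le_matSupNorm _ _ _).trans h.1
  have hle := h.2 Θ' hfeas
  have e1 : norm11 Θ = l1Norm (Θ i) + ∑ r ∈ Finset.univ.erase i, l1Norm (Θ r) :=
    (Finset.add_sum_erase _ (fun r => l1Norm (Θ r)) (Finset.mem_univ i)).symm
  have e2 : norm11 Θ' = l1Norm (Θ' i) + ∑ r ∈ Finset.univ.erase i, l1Norm (Θ' r) :=
    (Finset.add_sum_erase _ (fun r => l1Norm (Θ' r)) (Finset.mem_univ i)).symm
  have e3 : ∑ r ∈ Finset.univ.erase i, l1Norm (Θ' r) = ∑ r ∈ Finset.univ.erase i, l1Norm (Θ r) :=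
    Finset.sum_congr rfl fun r hrm => by rw [hr r (Finset.ne_of_mem_erase hrm)]
  rw [e1, e2, e3, hi] at hle
  linarith

lemma abs_mul_transpose_le {A B : Matrix (Fin n) (Fin n) ℝ} {a b : ℝ} (ha : 0 ≤ a)
    (hA : ∀ i j, |A i j| ≤ a) (hB : ∀ i, l1Norm (B i) ≤ b) (i j : Fin n) :
    |(A * Bᵀ) i j| ≤ a * b := by
  have : (A * Bᵀ) i j = A i ⬝ᵥ B j := by simp [Matrix.mul_apply, dotProduct]
  rw [this]
  exact (abs_dotProduct_le (hA i)).trans (mul_le_mul_of_nonneg_left (hB j) ha)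

lemma IsCLIME.matSupNorm_sub_le {μ M : ℝ} {Γ Θ W : Matrix (Fin n) (Fin n) ℝ}
    (h : IsCLIME μ Γ Θ) (hΓ : Γᵀ = Γ) (hW : Wᵀ = W) (hfeas : CLIMEFeasible μ Γ W)
    (hM0 : 0 ≤ M) (hM : opNormInf W ≤ M) :
    matSupNorm (Θ * Γ * Θᵀ - W) ≤ 3 * (M * μ) := by
  have hμ : 0 ≤ μ := (matSupNorm_nonneg _).trans hfeas
  have hWrow : ∀ i, l1Norm (W i) ≤ M := fun i => (l1Norm_row_le_opNormInf W i).trans hM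
  have hΘrow : ∀ i, l1Norm (Θ i) ≤ M := fun i => (h.l1Norm_row_le hfeas i).trans (hWrow i)
  have hE : ∀ i j, |(Θ * Γ - 1) i j| ≤ μ := fun i j => (abs_le_matSupNorm _ _ _).trans h.1
  have hE' : ∀ i j, |(W * Γ - 1) i j| ≤ μ := fun i j => (abs_le_matSupNorm _ _ _).trans hfeas
  -- The bracket equals `Θᵀ - W`: both of its products contain `W Γ Θᵀ`, which cancels. Each of the
  -- three terms pairs a residual with entries at most `μ` with rows of `ℓ₁` norm at most `M`.
  have hdec : Θ * Γ * Θᵀ - W = (Θ * Γ - 1) * Θᵀ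
      + (((Θ * Γ - 1) * Wᵀ)ᵀ - (W * Γ - 1) * Θᵀ) := by
    rw [hW, Matrix.transpose_mul, hW, Matrix.transpose_sub, Matrix.transpose_mul, hΓ,
      Matrix.transpose_one]
    noncomm_ring
  refine matSupNorm_le (by positivity) fun i j => ?_
  rw [hdec, Matrix.add_apply, Matrix.sub_apply, Matrix.transpose_apply]
  have h1 := abs_mul_transpose_le hμ hE hΘrow i j
  have h2 := abs_mul_transpose_le hμ hE hWrow j i
  have h3 := abs_mul_transpose_le hμ hE' hΘrow i j
  refine (abs_add_le _ _).trans ?_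
  have h4 := abs_sub (((Θ * Γ - 1) * Wᵀ) j i) (((W * Γ - 1) * Θᵀ) i j)
  linarith

lemma vecSupNorm_remainderTerm_le {X : Matrix (Fin N) (Fin n) ℝ} {Θ : Matrix (Fin n) (Fin n) ℝ}
    {μ : ℝ} (h : CLIMEFeasible μ (sampleCov X) Θ) (b β : Fin n → ℝ) :
    vecSupNorm (remainderTerm X Θ b β) ≤ √N * (μ * l1Norm (b - β)) := by
  have hμ : 0 ≤ μ := (matSupNorm_nonneg _).trans h
  have hl := l1Norm_nonneg (b - β)
  refine vecSupNorm_le (by positivity) fun i => ?_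
  rw [remainderTerm, Pi.smul_apply, smul_eq_mul, abs_mul, abs_of_nonneg (Real.sqrt_nonneg _)]
  refine mul_le_mul_of_nonneg_left ?_ (Real.sqrt_nonneg _)
  exact abs_dotProduct_le fun j => (abs_le_matSupNorm _ i j).trans h

lemma oneStep_sub_eq (X : Matrix (Fin N) (Fin n) ℝ) (Θ : Matrix (Fin n) (Fin n) ℝ)
    (b β : Fin n → ℝ) (ε : Fin N → ℝ) :
    √(N : ℝ) • (oneStep X (X *ᵥ β + ε) Θ b - β) = leadingTerm X Θ ε - remainderTerm X Θ b β := by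
  have hdiv : √(N : ℝ) * (1 / (N : ℝ)) = 1 / √(N : ℝ) := by
    rw [mul_one_div, Real.sqrt_div_self']
  have h1 : X *ᵥ β + ε - X *ᵥ b = ε - X *ᵥ (b - β) := by
    rw [Matrix.mulVec_sub]; abel
  have h2 : (Θ * sampleCov X) *ᵥ (b - β)
      = (1 / (N : ℝ)) • ((Θ * Xᵀ) *ᵥ (X *ᵥ (b - β))) := by
    rw [sampleCov, Matrix.mul_smul, Matrix.smul_mulVec, Matrix.mulVec_mulVec, Matrix.mul_assoc]
  rw [oneStep, leadingTerm, remainderTerm, h1, ← hdiv, Matrix.sub_mulVec, h2, Matrix.one_mulVec,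
    Matrix.mulVec_sub (Θ * Xᵀ)]
  simp only [smul_sub, smul_add, smul_smul]
  abel

end CLIME

/-! ### Lower bounds on quadratic forms from sums of signed coordinate vectors -/

section Maurey

variable {n : ℕ}

/-- The sign attached to a Boolean. -/
def boolSign (b : Bool) : ℝ := if b then 1 else -1

lemma boolSign_mul_self (b : Bool) : boolSign b * boolSign b = 1 := by
  cases b <;> simp [boolSign]

/-- The sum of the signed coordinate vectors listed by `f`. -/
def signedSum {r : ℕ} (f : Fin r → Fin n × Bool) : Fin n → ℝ :=
  ∑ l, Pi.single (f l).1 (boolSign (f l).2)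

/-- If a quadratic form is non-negative at `x + z` for all sums `z` of `r` signed coordinate
vectors, then so is its average when the vectors are drawn independently with mean `w`. -/
lemma quadForm_average_nonneg {Γ : Matrix (Fin n) (Fin n) ℝ} (hΓ : Γᵀ = Γ) {p : Fin n → ℝ}
    (hp : ∀ i, 0 ≤ p i) (hp1 : ∑ i, p i = 1) (s : Fin n → Bool) {w : Fin n → ℝ}
    (hw : ∀ i, w i = p i * boolSign (s i)) (r : ℕ) : ∀ x : Fin n → ℝ,
    (∀ f : Fin r → Fin n × Bool, 0 ≤ (x + signedSum f) ⬝ᵥ (Γ *ᵥ (x + signedSum f))) →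
    0 ≤ x ⬝ᵥ (Γ *ᵥ x) + 2 * r * (x ⬝ᵥ (Γ *ᵥ w)) + r * (∑ i, p i * Γ i i)
      + r * (r - 1) * (w ⬝ᵥ (Γ *ᵥ w)) := by
  have hsym : ∀ u v : Fin n → ℝ, u ⬝ᵥ (Γ *ᵥ v) = v ⬝ᵥ (Γ *ᵥ u) := by
    intro u v
    rw [Matrix.dotProduct_mulVec, ← Matrix.mulVec_transpose, hΓ, dotProduct_comm]
  have hwsum : ∀ u : Fin n → ℝ, ∑ i, p i * (boolSign (s i) * u i) = w ⬝ᵥ u := by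
    intro u
    simp only [dotProduct, hw, mul_assoc]
  induction r with
  | zero =>
    intro x h
    have := h Fin.elim0
    simpa [signedSum] using this
  | succ r ih =>
    intro x h
    obtain ⟨T, hT⟩ : ∃ T, T = ∑ i, p i * Γ i i := ⟨_, rfl⟩
    rw [← hT]
    simp only [← hT] at ih
    have hstep : ∀ i, 0 ≤ x ⬝ᵥ (Γ *ᵥ x) + 2 * (boolSign (s i) * (Γ *ᵥ x) i) + Γ i i
        + 2 * r * (x ⬝ᵥ (Γ *ᵥ w) + boolSign (s i) * (Γ *ᵥ w) i) + r * T
        + r * (r - 1) * (w ⬝ᵥ (Γ *ᵥ w)) := by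
      intro i
      set e : Fin n → ℝ := Pi.single i (boolSign (s i)) with he
      -- The first drawn vector is absorbed into the base point, which is why the induction is over
      -- all `x`.
      have h1 := ih (x + e) (fun f => by
        have := h (Fin.cons (i, s i) f)
        simpa [signedSum, Fin.sum_univ_succ, add_assoc, he] using this)
      have e1 : ∀ u : Fin n → ℝ, e ⬝ᵥ u = boolSign (s i) * u i := by
        intro u; simp [he]
      have e2 : e ⬝ᵥ (Γ *ᵥ e) = Γ i i := by
        rw [e1]
        have : (Γ *ᵥ e) i = Γ i i * boolSign (s i) := by simp [he, Matrix.mulVec_single]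
        rw [this, mul_left_comm, boolSign_mul_self, mul_one]
      rw [Matrix.mulVec_add, add_dotProduct, dotProduct_add, dotProduct_add, e2, hsym x e, e1,
        add_dotProduct, e1] at h1
      linarith
    have hsum := Finset.sum_nonneg fun i (_ : i ∈ Finset.univ) => mul_nonneg (hp i) (hstep i)
    have hexp : ∑ i, p i * (x ⬝ᵥ (Γ *ᵥ x) + 2 * (boolSign (s i) * (Γ *ᵥ x) i) + Γ i i
        + 2 * r * (x ⬝ᵥ (Γ *ᵥ w) + boolSign (s i) * (Γ *ᵥ w) i) + r * T
        + r * (r - 1) * (w ⬝ᵥ (Γ *ᵥ w)))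
        = (∑ i, p i) * (x ⬝ᵥ (Γ *ᵥ x) + 2 * r * (x ⬝ᵥ (Γ *ᵥ w)) + r * T
          + r * (r - 1) * (w ⬝ᵥ (Γ *ᵥ w)))
          + 2 * (∑ i, p i * (boolSign (s i) * (Γ *ᵥ x) i)) + (∑ i, p i * Γ i i)
          + 2 * r * (∑ i, p i * (boolSign (s i) * (Γ *ᵥ w) i)) := by
      rw [Finset.sum_mul, Finset.mul_sum, Finset.mul_sum, ← Finset.sum_add_distrib,
        ← Finset.sum_add_distrib, ← Finset.sum_add_distrib]
      exact Finset.sum_congr rfl fun i _ => by ring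
    rw [hexp, hp1, ← hT, hwsum, hwsum, hsym w x] at hsum
    push_cast
    linarith

/-- Maurey's empirical method: draw `m + 1` signed coordinate vectors with mean `v / ‖v‖₁`,
coordinate `i` having probability `|v_i| / ‖v‖₁`. In the averaged form the diagonal pairs cost at
most `(m + 1) D`, and the off-diagonal ones give `(m + 1) m` copies of the form at the mean. -/
lemma quadForm_lower_bound {Γ : Matrix (Fin n) (Fin n) ℝ} (hΓ : Γᵀ = Γ) {D : ℝ}
    (hD : ∀ i, Γ i i ≤ D) {m : ℕ}
    (h : ∀ f : Fin (m + 1) → Fin n × Bool, 0 ≤ signedSum f ⬝ᵥ (Γ *ᵥ signedSum f))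
    (v : Fin n → ℝ) : 0 ≤ D * l1Norm v ^ 2 + m * (v ⬝ᵥ (Γ *ᵥ v)) := by
  rcases (l1Norm_nonneg v).eq_or_lt with h0 | hL
  · have hv : v = 0 := by
      funext i
      have := (Finset.sum_eq_zero_iff_of_nonneg (fun i _ => abs_nonneg (v i))).1 h0.symm i
        (Finset.mem_univ i)
      simpa using this
    simp [hv, l1Norm]
  set L := l1Norm v with hLdef
  have key := quadForm_average_nonneg hΓ (p := fun i => |v i| / L) (fun i => by positivity)
    (by rw [← Finset.sum_div]; exact div_self hL.ne') (fun i => decide (0 ≤ v i))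
    (w := L⁻¹ • v) (fun i => by
      simp only [Pi.smul_apply, smul_eq_mul, boolSign, decide_eq_true_eq]
      split_ifs with hi
      · rw [abs_of_nonneg hi]; ring
      · rw [abs_of_neg (not_le.1 hi)]; ring) (m + 1) 0 (by simpa using h)
  have hT : ∑ i, |v i| / L * Γ i i ≤ D := by
    calc ∑ i, |v i| / L * Γ i i ≤ ∑ i, |v i| / L * D := by
          gcongr with i
          exact hD i
      _ = D := by
          rw [← Finset.sum_mul, ← Finset.sum_div]
          exact (congrArg (· * D) (div_self hL.ne')).trans (one_mul D)
  simp only [zero_dotProduct, mul_zero, zero_add, Matrix.mulVec_smul, dotProduct_smul,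
    smul_dotProduct, smul_eq_mul] at key
  push_cast at key
  have hm : (0 : ℝ) < (m : ℝ) + 1 := by positivity
  have h2 : 0 ≤ ((m : ℝ) + 1) * (D + m * (L⁻¹ * (L⁻¹ * (v ⬝ᵥ (Γ *ᵥ v))))) := by
    have := mul_le_mul_of_nonneg_left hT hm.le
    linarith
  have h3 := nonneg_of_mul_nonneg_right h2 hm
  have h4 := mul_nonneg h3 (sq_nonneg L)
  have h5 : (D + m * (L⁻¹ * (L⁻¹ * (v ⬝ᵥ (Γ *ᵥ v))))) * L ^ 2
      = D * L ^ 2 + m * (v ⬝ᵥ (Γ *ᵥ v)) := by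
    field_simp
  rwa [h5] at h4

/-- Apply Maurey's bound to `Γ - (c / 2) I`. On the cone the loss `D ‖v‖₁² / (m s)` is at most `36 D
‖v‖² / m`, hence at most `c ‖v‖² / 4`; this is where `144 = 4 · 36` comes from. -/
lemma restricted_eigenvalue {Γ : Matrix (Fin n) (Fin n) ℝ} (hΓ : Γᵀ = Γ) {D c : ℝ} (hc : 0 < c)
    (hD : ∀ i, Γ i i ≤ D) (hDpos : 0 < D) {m s : ℕ} (hs : 0 < s) (hm : 144 * D ≤ c * m)
    (h : ∀ f : Fin (m * s + 1) → Fin n × Bool,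
      c / 2 * (signedSum f ⬝ᵥ signedSum f) ≤ signedSum f ⬝ᵥ (Γ *ᵥ signedSum f))
    (v : Fin n → ℝ) (hv : l1Norm v ^ 2 ≤ 36 * s * (v ⬝ᵥ v)) :
    c / 4 * (v ⬝ᵥ v) ≤ v ⬝ᵥ (Γ *ᵥ v) := by
  have hquad : ∀ u : Fin n → ℝ, u ⬝ᵥ ((Γ - (c / 2) • (1 : Matrix (Fin n) (Fin n) ℝ)) *ᵥ u)
      = u ⬝ᵥ (Γ *ᵥ u) - c / 2 * (u ⬝ᵥ u) := by
    intro u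
    rw [Matrix.sub_mulVec, Matrix.smul_mulVec, Matrix.one_mulVec, dotProduct_sub, dotProduct_smul,
      smul_eq_mul]
  have key := quadForm_lower_bound (Γ := Γ - (c / 2) • (1 : Matrix (Fin n) (Fin n) ℝ)) (D := D)
    (m := m * s) (by simp [Matrix.transpose_sub, hΓ]) (fun i => by
      simp only [Matrix.sub_apply, Matrix.smul_apply, Matrix.one_apply_eq, smul_eq_mul]
      have := hD i
      linarith) (fun f => by rw [hquad]; linarith [h f]) v
  rw [hquad] at key
  have hq := dotProduct_self_nonneg' v
  have hmpos : (0 : ℝ) < m := by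
    by_contra hcon
    have : c * (m : ℝ) ≤ 0 := mul_nonpos_of_nonneg_of_nonpos hc.le (not_lt.1 hcon)
    linarith
  have hs' : (0 : ℝ) < s := by exact_mod_cast hs
  have h1 : D * l1Norm v ^ 2 ≤ D * (36 * s * (v ⬝ᵥ v)) := mul_le_mul_of_nonneg_left hv hDpos.le
  have h2 : 36 * D * (s * (v ⬝ᵥ v)) ≤ c * m / 4 * (s * (v ⬝ᵥ v)) :=
    mul_le_mul_of_nonneg_right (by linarith) (by positivity)
  push_cast at key
  have h3 : 0 ≤ (m * s : ℝ) * (v ⬝ᵥ (Γ *ᵥ v) - c / 4 * (v ⬝ᵥ v)) := by nlinarith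
  have h4 := nonneg_of_mul_nonneg_right h3 (by positivity)
  linarith

end Maurey

/-! ### Exponential moments of products of sub-Gaussian variables -/

section Moments

/-- The quotient `(2p)! / p!` is a product of `p` factors, each at most `2p`. -/
lemma two_mul_factorial_le (p : ℕ) :
    ((2 * p).factorial : ℝ) ≤ p.factorial * (2 * p : ℝ) ^ p := by
  have h := Nat.factorial_mul_ascFactorial p p
  have h2 := Nat.ascFactorial_le_pow_add p p
  rw [two_mul, ← h]
  push_cast
  have h3 : (((p + 1).ascFactorial p : ℕ) : ℝ) ≤ ((p : ℝ) + p) ^ p := by exact_mod_cast h2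
  rw [two_mul]
  gcongr

lemma pow_div_factorial_le_cosh (x : ℝ) (p : ℕ) :
    x ^ (2 * p) / (2 * p).factorial ≤ Real.cosh x := by
  refine le_hasSum (Real.hasSum_cosh x) p fun q _ => ?_
  have : 0 ≤ x ^ (2 * q) := (even_two_mul q).pow_nonneg x
  positivity

/-- The bound on the Taylor coefficients of `exp (x² / (6 σ²))` by hyperbolic cosines. -/
lemma sq_pow_div_factorial_le {σ : ℝ} (hσ : 0 < σ) (x : ℝ) (p : ℕ) :
    (1 / (6 * σ ^ 2) * x ^ 2) ^ p / p.factorial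
      ≤ (1 / 6) ^ p * Real.cosh (√(2 * p) / σ * x) := by
  have h1 := pow_div_factorial_le_cosh (√(2 * p) / σ * x) p
  have h2 : (√(2 * p) / σ * x) ^ (2 * p) = (2 * p : ℝ) ^ p * (x ^ 2 / σ ^ 2) ^ p := by
    rw [pow_mul, mul_pow, div_pow, Real.sq_sqrt (by positivity), ← mul_pow]
    congr 1
    ring
  rw [h2] at h1
  have h3 : (x ^ 2 / σ ^ 2) ^ p / p.factorial
      ≤ (2 * p : ℝ) ^ p * (x ^ 2 / σ ^ 2) ^ p / (2 * p).factorial := by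
    rw [div_le_div_iff₀ (by positivity) (by positivity)]
    have := mul_le_mul_of_nonneg_left (two_mul_factorial_le p)
      (show 0 ≤ (x ^ 2 / σ ^ 2) ^ p by positivity)
    linarith
  calc (1 / (6 * σ ^ 2) * x ^ 2) ^ p / p.factorial
      = (1 / 6) ^ p * ((x ^ 2 / σ ^ 2) ^ p / p.factorial) := by
        rw [← mul_div_assoc, ← mul_pow]
        congr 2
        field_simp
    _ ≤ _ := by gcongr; exact h3.trans h1

variable {E : Type*} [MeasurableSpace E] {Q : Measure E}

lemma lintegral_cosh_le {σ : ℝ} {Z : E → ℝ}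
    (hZ : HasSubgaussianMGF Z ⟨σ ^ 2, sq_nonneg σ⟩ Q) (t : ℝ) :
    ∫⁻ x, ENNReal.ofReal (Real.cosh (t * Z x)) ∂Q ≤ ENNReal.ofReal (Real.exp (σ ^ 2 * t ^ 2 / 2)) := by
  have hi1 := hZ.integrable_exp_mul t
  have hi2 := hZ.integrable_exp_mul (-t)
  have hm1 := hZ.mgf_le t
  have hm2 := hZ.mgf_le (-t)
  simp only [mgf, neg_sq] at hm1 hm2
  have heq : ∀ x, Real.cosh (t * Z x) = (Real.exp (t * Z x) + Real.exp (-t * Z x)) / 2 := by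
    intro x; rw [Real.cosh_eq, neg_mul]
  simp only [heq]
  have hi : Integrable (fun x => (Real.exp (t * Z x) + Real.exp (-t * Z x)) / 2) Q :=
    (hi1.add hi2).div_const 2
  rw [← ofReal_integral_eq_lintegral_ofReal hi (ae_of_all _ fun x => by positivity)]
  apply ENNReal.ofReal_le_ofReal
  rw [integral_div, integral_add hi1 hi2]
  change _ ≤ Real.exp ((σ ^ 2) * t ^ 2 / 2) at hm1
  change _ ≤ Real.exp ((σ ^ 2) * t ^ 2 / 2) at hm2
  linarith

/-- In the power series, the sub-Gaussian bound at `t = √(2p) / σ` makes the `p`-th term at most `(e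
/ 6)^p ≤ 2^(-p)`, since `e < 3`; the geometric series sums to 2. -/
lemma lintegral_exp_sq_le_two {σ : ℝ} (hσ : 0 < σ) {Z : E → ℝ}
    (hZ : HasSubgaussianMGF Z ⟨σ ^ 2, sq_nonneg σ⟩ Q) :
    ∫⁻ x, ENNReal.ofReal (Real.exp (1 / (6 * σ ^ 2) * Z x ^ 2)) ∂Q ≤ 2 := by
  have hexp : ∀ x, ENNReal.ofReal (Real.exp (1 / (6 * σ ^ 2) * Z x ^ 2))
      = ∑' p : ℕ, ENNReal.ofReal ((1 / (6 * σ ^ 2) * Z x ^ 2) ^ p / p.factorial) := by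
    intro x
    have hs := NormedSpace.expSeries_div_hasSum_exp (1 / (6 * σ ^ 2) * Z x ^ 2)
    rw [Real.exp_eq_exp_ℝ, ← hs.tsum_eq, ENNReal.ofReal_tsum_of_nonneg (fun p => by positivity) hs.summable]
  simp only [hexp]
  have hmeas := hZ.aemeasurable
  rw [lintegral_tsum fun p => by fun_prop]
  have hterm : ∀ p : ℕ, ∫⁻ x, ENNReal.ofReal ((1 / (6 * σ ^ 2) * Z x ^ 2) ^ p / p.factorial) ∂Q
      ≤ ENNReal.ofReal ((1 / 2) ^ p) := by
    intro p
    calc ∫⁻ x, ENNReal.ofReal ((1 / (6 * σ ^ 2) * Z x ^ 2) ^ p / p.factorial) ∂Q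
        ≤ ∫⁻ x, ENNReal.ofReal ((1 / 6) ^ p) *
            ENNReal.ofReal (Real.cosh (√(2 * p) / σ * Z x)) ∂Q := by
          refine lintegral_mono fun x => ?_
          rw [← ENNReal.ofReal_mul (by positivity)]
          exact ENNReal.ofReal_le_ofReal (sq_pow_div_factorial_le hσ (Z x) p)
      _ = ENNReal.ofReal ((1 / 6) ^ p) *
            ∫⁻ x, ENNReal.ofReal (Real.cosh (√(2 * p) / σ * Z x)) ∂Q :=
          lintegral_const_mul' _ _ ENNReal.ofReal_ne_top
      _ ≤ ENNReal.ofReal ((1 / 6) ^ p) *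
            ENNReal.ofReal (Real.exp (σ ^ 2 * (√(2 * p) / σ) ^ 2 / 2)) := by
          gcongr
          exact lintegral_cosh_le hZ _
      _ ≤ ENNReal.ofReal ((1 / 2) ^ p) := by
          rw [← ENNReal.ofReal_mul (by positivity)]
          apply ENNReal.ofReal_le_ofReal
          have : σ ^ 2 * (√(2 * p) / σ) ^ 2 / 2 = p * 1 := by
            rw [div_pow, Real.sq_sqrt (by positivity)]
            field_simp
          rw [this, Real.exp_nat_mul, ← mul_pow]
          have := Real.exp_one_lt_d9
          gcongr
          linarith
  calc ∑' p : ℕ, ∫⁻ x, ENNReal.ofReal ((1 / (6 * σ ^ 2) * Z x ^ 2) ^ p / p.factorial) ∂Q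
      ≤ ∑' p : ℕ, ENNReal.ofReal ((1 / 2) ^ p) := ENNReal.tsum_le_tsum hterm
    _ = 2 := by
        rw [← ENNReal.ofReal_tsum_of_nonneg (fun p => by positivity) summable_geometric_two,
          tsum_geometric_two]
        norm_num

/-- The Taylor remainder is at most `|tw|² exp |tw|`. Half of the exponent `a |w|` pays for the
exponential, the other half for the square through `z² ≤ 2 exp z`. -/
lemma exp_mul_le_quadratic {a t w : ℝ} (ha : 0 < a) (ht : |t| ≤ a / 2) :
    Real.exp (t * w) ≤ 1 + t * w + 8 * t ^ 2 / a ^ 2 * Real.exp (a * |w|) := by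
  have h1 : |Real.exp (t * w) - (1 + t * w)| ≤ |t * w| ^ 2 * Real.exp |t * w| := by
    have := Complex.norm_exp_sub_sum_le_norm_mul_exp ((t * w : ℝ) : ℂ) 2
    rw [Complex.norm_real, Real.norm_eq_abs] at this
    convert this using 1
    rw [← Real.norm_eq_abs, ← Complex.norm_real]
    congr 1
    simp [Finset.sum_range_succ]
  have h2 := (le_abs_self _).trans h1
  set z := a / 2 * |w| with hz
  have hz0 : 0 ≤ z := by positivity
  have h3 : |t * w| ≤ z := by
    rw [abs_mul]; exact mul_le_mul_of_nonneg_right ht (abs_nonneg _)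
  have h4 : z ^ 2 ≤ 2 * Real.exp z := by
    have := Real.quadratic_le_exp_of_nonneg hz0
    nlinarith
  have h5 : |t * w| ^ 2 = 4 * t ^ 2 / a ^ 2 * z ^ 2 := by
    rw [abs_mul, mul_pow, sq_abs, hz, mul_pow]
    field_simp
    norm_num
  have h6 : Real.exp (a * |w|) = Real.exp z * Real.exp z := by
    rw [← Real.exp_add]; congr 1; rw [hz]; ring
  have h7 : |t * w| ^ 2 * Real.exp |t * w| ≤ 8 * t ^ 2 / a ^ 2 * Real.exp (a * |w|) := by
    calc |t * w| ^ 2 * Real.exp |t * w| ≤ (4 * t ^ 2 / a ^ 2 * (2 * Real.exp z)) * Real.exp z := by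
          rw [h5]
          gcongr
      _ = _ := by rw [h6]; ring
  linarith

/-- Bernstein-type bound for the centred product of two variables whose squares have an
exponential moment. -/
lemma lintegral_exp_mul_sub_le [IsProbabilityMeasure Q] {a : ℝ} (ha : 0 < a) {U V : E → ℝ}
    (hU : AEMeasurable U Q) (hV : AEMeasurable V Q)
    (hU2 : ∫⁻ x, ENNReal.ofReal (Real.exp (a * U x ^ 2)) ∂Q ≤ 2)
    (hV2 : ∫⁻ x, ENNReal.ofReal (Real.exp (a * V x ^ 2)) ∂Q ≤ 2) {t : ℝ} (ht : |t| ≤ a / 2) :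
    ∫⁻ x, ENNReal.ofReal (Real.exp (t * (U x * V x - ∫ y, U y * V y ∂Q))) ∂Q
      ≤ ENNReal.ofReal (Real.exp (128 * t ^ 2 / a ^ 2)) := by
  set m := ∫ y, U y * V y ∂Q with hm
  have hint : ∀ {f : E → ℝ}, AEMeasurable f Q →
      ∫⁻ x, ENNReal.ofReal (Real.exp (a * f x ^ 2)) ∂Q ≤ 2 →
      Integrable (fun x => Real.exp (a * f x ^ 2)) Q ∧ ∫ x, Real.exp (a * f x ^ 2) ∂Q ≤ 2 := by
    intro f hf h2
    have hi : Integrable (fun x => Real.exp (a * f x ^ 2)) Q := by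
      rw [← lintegral_ofReal_ne_top_iff_integrable
        (AEMeasurable.aestronglyMeasurable (by fun_prop)) (ae_of_all _ fun x => (Real.exp_pos _).le)]
      exact (h2.trans_lt (by simp)).ne
    refine ⟨hi, ?_⟩
    rw [← ofReal_integral_eq_lintegral_ofReal hi (ae_of_all _ fun x => (Real.exp_pos _).le)] at h2
    exact (ENNReal.ofReal_le_ofReal_iff (by norm_num)).1 (by simpa using h2)
  obtain ⟨iU, bU⟩ := hint hU hU2
  obtain ⟨iV, bV⟩ := hint hV hV2
  have hpt : ∀ x, Real.exp (a * |U x * V x|)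
      ≤ (Real.exp (a * U x ^ 2) + Real.exp (a * V x ^ 2)) / 2 := by
    intro x
    have h1 : a * |U x * V x| ≤ (a * U x ^ 2) / 2 + (a * V x ^ 2) / 2 := by
      rw [abs_mul, ← sq_abs (U x), ← sq_abs (V x)]
      nlinarith [mul_nonneg ha.le (sq_nonneg (|U x| - |V x|))]
    have e1 : Real.exp (a * U x ^ 2) = Real.exp ((a * U x ^ 2) / 2) ^ 2 := by
      rw [← Real.exp_nat_mul]; congr 1; push_cast; ring
    have e2 : Real.exp (a * V x ^ 2) = Real.exp ((a * V x ^ 2) / 2) ^ 2 := by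
      rw [← Real.exp_nat_mul]; congr 1; push_cast; ring
    rw [e1, e2]
    refine (Real.exp_le_exp.2 h1).trans ?_
    rw [Real.exp_add]
    nlinarith [sq_nonneg (Real.exp ((a * U x ^ 2) / 2) - Real.exp ((a * V x ^ 2) / 2))]
  have iB : Integrable (fun x => (Real.exp (a * U x ^ 2) + Real.exp (a * V x ^ 2)) / 2) Q :=
    (iU.add iV).div_const 2
  have iW : Integrable (fun x => Real.exp (a * |U x * V x|)) Q := by
    refine iB.mono' (AEMeasurable.aestronglyMeasurable (by fun_prop)) (ae_of_all _ fun x => ?_)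
    rw [Real.norm_eq_abs, abs_of_pos (Real.exp_pos _)]
    exact hpt x
  have bW : ∫ x, Real.exp (a * |U x * V x|) ∂Q ≤ 2 := by
    refine (integral_mono iW iB hpt).trans ?_
    rw [integral_div, integral_add iU iV]
    linarith
  have hlin : ∀ x, |U x * V x| ≤ 1 / a * Real.exp (a * |U x * V x|) := by
    intro x
    have := Real.add_one_le_exp (a * |U x * V x|)
    rw [one_div, ← div_eq_inv_mul, le_div_iff₀ ha]
    linarith
  have iUV : Integrable (fun x => U x * V x) Q := by
    refine (iW.const_mul (1 / a)).mono' (AEMeasurable.aestronglyMeasurable (by fun_prop))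
      (ae_of_all _ fun x => ?_)
    rw [Real.norm_eq_abs]
    exact hlin x
  have hm2 : a * |m| ≤ 2 := by
    have h1 : |m| ≤ ∫ x, 1 / a * Real.exp (a * |U x * V x|) ∂Q :=
      (abs_integral_le_integral_abs).trans (integral_mono iUV.abs (iW.const_mul _) hlin)
    rw [integral_const_mul] at h1
    calc a * |m| ≤ a * (1 / a * 2) := by gcongr; exact h1.trans (by gcongr)
      _ = 2 := by field_simp
  have hexp2 : Real.exp 2 ≤ 8 := by
    have h := Real.exp_one_lt_d9
    have : Real.exp 2 = Real.exp 1 * Real.exp 1 := by rw [← Real.exp_add]; norm_num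
    rw [this]
    nlinarith [Real.exp_pos 1]
  -- Centring costs `exp (a |m|) ≤ e² ≤ 8`. It turns the 8 of the quadratic bound into 64, and the
  -- integral bound 2 then gives 128.
  have hcent : ∀ x, Real.exp (a * |U x * V x - m|) ≤ 8 * Real.exp (a * |U x * V x|) := by
    intro x
    have h1 : a * |U x * V x - m| ≤ 2 + a * |U x * V x| := by
      have := mul_le_mul_of_nonneg_left (abs_sub (U x * V x) m) ha.le
      linarith
    refine (Real.exp_le_exp.2 h1).trans ?_
    rw [Real.exp_add]
    gcongr
  have hbound : ∀ x, Real.exp (t * (U x * V x - m))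
      ≤ 1 + t * (U x * V x - m) + 64 * t ^ 2 / a ^ 2 * Real.exp (a * |U x * V x|) := by
    intro x
    refine (exp_mul_le_quadratic ha ht).trans ?_
    have := mul_le_mul_of_nonneg_left (hcent x) (show 0 ≤ 8 * t ^ 2 / a ^ 2 by positivity)
    have e : 8 * t ^ 2 / a ^ 2 * (8 * Real.exp (a * |U x * V x|))
        = 64 * t ^ 2 / a ^ 2 * Real.exp (a * |U x * V x|) := by ring
    linarith
  have i0 : Integrable (fun x => t * (U x * V x - m)) Q :=
    (iUV.sub (integrable_const _)).const_mul t
  have i1 : Integrable (fun x => 1 + t * (U x * V x - m)) Q := (integrable_const _).add i0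
  have i2 : Integrable (fun x => 64 * t ^ 2 / a ^ 2 * Real.exp (a * |U x * V x|)) Q :=
    iW.const_mul _
  have hval : ∫ x, (1 + t * (U x * V x - m) + 64 * t ^ 2 / a ^ 2 * Real.exp (a * |U x * V x|)) ∂Q
      ≤ Real.exp (128 * t ^ 2 / a ^ 2) := by
    rw [integral_add i1 i2, integral_add (integrable_const _) i0, integral_const_mul, integral_const_mul,
      integral_sub iUV (integrable_const _), ← hm]
    simp only [integral_const, probReal_univ, smul_eq_mul, one_mul, sub_self, mul_zero, add_zero]
    have h1 := mul_le_mul_of_nonneg_left bW (show 0 ≤ 64 * t ^ 2 / a ^ 2 by positivity)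
    have h2 := Real.add_one_le_exp (128 * t ^ 2 / a ^ 2)
    have e : 64 * t ^ 2 / a ^ 2 * 2 = 128 * t ^ 2 / a ^ 2 := by ring
    linarith
  calc ∫⁻ x, ENNReal.ofReal (Real.exp (t * (U x * V x - m))) ∂Q
      ≤ ∫⁻ x, ENNReal.ofReal (1 + t * (U x * V x - m)
          + 64 * t ^ 2 / a ^ 2 * Real.exp (a * |U x * V x|)) ∂Q :=
        lintegral_mono fun x => ENNReal.ofReal_le_ofReal (hbound x)
    _ = ENNReal.ofReal (∫ x, (1 + t * (U x * V x - m)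
          + 64 * t ^ 2 / a ^ 2 * Real.exp (a * |U x * V x|)) ∂Q) :=
        (ofReal_integral_eq_lintegral_ofReal (i1.add i2)
          (ae_of_all _ fun x => (Real.exp_pos _).le.trans (hbound x))).symm
    _ ≤ _ := ENNReal.ofReal_le_ofReal hval

/-- Chernoff's bound for a sum of functions of the coordinates under a product measure. -/
lemma pi_le_sum_le {ι : Type*} [Fintype ι] {Q : Measure E} [IsProbabilityMeasure Q]
    {f : ι → E → ℝ} (hf : ∀ i, Measurable (f i)) {c : ι → ℝ}
    (h : ∀ i, ∫⁻ x, ENNReal.ofReal (Real.exp (f i x)) ∂Q ≤ ENNReal.ofReal (Real.exp (c i))) (b : ℝ) :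
    Measure.pi (fun _ : ι => Q) {x | b ≤ ∑ i, f i (x i)}
      ≤ ENNReal.ofReal (Real.exp (∑ i, c i - b)) := by
  have hind : iIndepFun (fun i (x : ι → E) => ENNReal.ofReal (Real.exp (f i (x i))))
      (Measure.pi fun _ : ι => Q) :=
    iIndepFun_pi (X := fun i x => ENNReal.ofReal (Real.exp (f i x))) fun i => by
      have := hf i
      fun_prop
  have hprod := lintegral_prod_eq_prod_lintegral_of_indepFun Finset.univ _ hind fun i => by
    have := hf i
    fun_prop
  have hsub : {x : ι → E | b ≤ ∑ i, f i (x i)} ⊆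
      {x | ENNReal.ofReal (Real.exp b) ≤ ∏ i, ENNReal.ofReal (Real.exp (f i (x i)))} := by
    intro x hx
    rw [Set.mem_ofPred_eq] at hx ⊢
    rw [← ENNReal.ofReal_prod_of_nonneg fun i _ => (Real.exp_pos _).le, ← Real.exp_sum]
    exact ENNReal.ofReal_le_ofReal (Real.exp_le_exp.2 hx)
  refine (measure_mono hsub).trans ?_
  refine (meas_ge_le_lintegral_div ?_ (by simp [Real.exp_pos]) ENNReal.ofReal_ne_top).trans ?_
  · refine Measurable.aemeasurable (Finset.measurable_prod _ fun i _ => ?_)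
    have := hf i
    fun_prop
  rw [hprod]
  have hi : ∀ i, ∫⁻ x : ι → E, ENNReal.ofReal (Real.exp (f i (x i))) ∂(Measure.pi fun _ : ι => Q)
      ≤ ENNReal.ofReal (Real.exp (c i)) := by
    intro i
    have := (measurePreserving_eval (fun _ : ι => Q) i).lintegral_comp
      (f := fun x => ENNReal.ofReal (Real.exp (f i x))) (by have := hf i; fun_prop)
    rw [this]
    exact h i
  rw [Real.exp_sub, ENNReal.ofReal_div_of_pos (Real.exp_pos _)]
  refine ENNReal.div_le_div_right ?_ _
  rw [Real.exp_sum, ENNReal.ofReal_prod_of_nonneg fun i _ => (Real.exp_pos _).le]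
  exact Finset.prod_le_prod' fun i _ => hi i

end Moments

/-! ### Concentration of quadratic forms of the sample covariance -/

section Concentration

variable {N n : ℕ} {Q : Measure (Fin n → ℝ)} {σ : ℝ} {S : Matrix (Fin n) (Fin n) ℝ}

/-- Rescaling to a unit vector only shrinks the variance proxy. Vectors of norm below 1 are needed
for scaled rows of `S⁻¹`, and the zero vector for signed sums that cancel. -/
lemma IsSubGaussianLaw.hasSubgaussianMGF [IsProbabilityMeasure Q] (hQ : IsSubGaussianLaw σ Q)
    {u : Fin n → ℝ} (hu : u ⬝ᵥ u ≤ 1) :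
    HasSubgaussianMGF (fun x => u ⬝ᵥ x) ⟨σ ^ 2, sq_nonneg σ⟩ Q := by
  rcases (dotProduct_self_nonneg' u).eq_or_lt with h0 | h0
  · have : u = 0 := dotProduct_self_eq_zero.1 h0.symm
    subst this
    refine ⟨fun t => by simp, fun t => ?_⟩
    simp only [zero_dotProduct, mgf, mul_zero, Real.exp_zero, integral_const, probReal_univ,
      smul_eq_mul, mul_one]
    exact Real.one_le_exp
      (div_nonneg (mul_nonneg (NNReal.coe_nonneg _) (sq_nonneg t)) zero_le_two)
  set r := √(u ⬝ᵥ u) with hr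
  have hrpos : 0 < r := Real.sqrt_pos.2 h0
  have hrr : r * r = u ⬝ᵥ u := Real.mul_self_sqrt h0.le
  have hunit : (r⁻¹ • u) ⬝ᵥ (r⁻¹ • u) = 1 := by
    rw [smul_dotProduct, dotProduct_smul, smul_eq_mul, smul_eq_mul, ← hrr]
    field_simp
  have h := (hQ.2 _ hunit).2
  have heq : ∀ (t : ℝ) (x : Fin n → ℝ), t * (u ⬝ᵥ x) = (t * r) * ((r⁻¹ • u) ⬝ᵥ x) := by
    intro t x
    rw [smul_dotProduct, smul_eq_mul]
    field_simp
  refine ⟨fun t => ?_, fun t => ?_⟩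
  · simp only [heq]
    exact h.integrable_exp_mul _
  · simp only [mgf, heq]
    refine (h.mgf_le (t * r)).trans (Real.exp_le_exp.2 ?_)
    have : (t * r) ^ 2 ≤ t ^ 2 := by
      rw [mul_pow, sq r, hrr]
      nlinarith [sq_nonneg t]
    gcongr
    exact NNReal.coe_nonneg _

lemma IsSubGaussianLaw.integral_mul [IsProbabilityMeasure Q] (hQ : IsSubGaussianLaw σ Q)
    (hS : ∀ a b, cov[fun x => x a, fun x => x b; Q] = S a b) (u v : Fin n → ℝ) :
    ∫ x, (u ⬝ᵥ x) * (v ⬝ᵥ x) ∂Q = u ⬝ᵥ (S *ᵥ v) := by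
  have hmem : ∀ a, MemLp (fun x : Fin n → ℝ => x a) 2 Q := by
    intro a
    have := (hQ.hasSubgaussianMGF (u := Pi.single a 1) (by simp)).memLp 2
    simpa using this
  have hint : ∀ a b, Integrable (fun x : Fin n → ℝ => x a * x b) Q :=
    fun a b => (hmem a).integrable_mul (hmem b)
  have hab : ∀ a b, ∫ x, x a * x b ∂Q = S a b := by
    intro a b
    rw [← hS a b, covariance]
    simp [hQ.1]
  have hexp : ∀ x : Fin n → ℝ, (u ⬝ᵥ x) * (v ⬝ᵥ x) = ∑ a, ∑ b, u a * v b * (x a * x b) := by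
    intro x
    simp only [dotProduct, Finset.sum_mul_sum]
    exact Finset.sum_congr rfl fun a _ => Finset.sum_congr rfl fun b _ => by ring
  simp only [hexp]
  rw [integral_finsetSum _ fun a _ => integrable_finsetSum _ fun b _ => (hint a b).const_mul _]
  simp only [dotProduct, Matrix.mulVec, Finset.mul_sum]
  refine Finset.sum_congr rfl fun a _ => ?_
  rw [integral_finsetSum _ fun b _ => (hint a b).const_mul _]
  refine Finset.sum_congr rfl fun b _ => ?_
  rw [integral_const_mul, hab]
  ring

lemma measure_lt_abs_le {N : ℕ} [IsProbabilityMeasure Q] (hσ : 0 < σ) (hQ : IsSubGaussianLaw σ Q)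
    (hS : ∀ a b, cov[fun x => x a, fun x => x b; Q] = S a b) (hN : 0 < N) {u v : Fin n → ℝ}
    (hu : u ⬝ᵥ u ≤ 1) (hv : v ⬝ᵥ v ≤ 1) {a b : ℝ} (ha : a = 1 / (6 * σ ^ 2)) (hb : 0 ≤ b)
    (hb' : b ≤ 128 / a) :
    Measure.pi (fun _ : Fin N => Q)
      {A | b < |u ⬝ᵥ (sampleCov (Matrix.of A) *ᵥ v) - u ⬝ᵥ (S *ᵥ v)|}
      ≤ ENNReal.ofReal (2 * Real.exp (-(a ^ 2 / 512 * (N * b ^ 2)))) := by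
  have ha0 : 0 < a := by rw [ha]; positivity
  have hN' : (0 : ℝ) < N := by exact_mod_cast hN
  have hUm : Measurable fun x : Fin n → ℝ => u ⬝ᵥ x := by unfold dotProduct; fun_prop
  have hVm : Measurable fun x : Fin n → ℝ => v ⬝ᵥ x := by unfold dotProduct; fun_prop
  have hmgf := fun t => lintegral_exp_mul_sub_le (Q := Q) (t := t) ha0 hUm.aemeasurable
    hVm.aemeasurable (by rw [ha]; exact lintegral_exp_sq_le_two hσ (hQ.hasSubgaussianMGF hu))
    (by rw [ha]; exact lintegral_exp_sq_le_two hσ (hQ.hasSubgaussianMGF hv))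
  rw [hQ.integral_mul hS] at hmgf
  set m := u ⬝ᵥ (S *ᵥ v) with hm
  -- The minimiser of `128 t² / a² - t b`, with value `-a² b² / 512`; the bound on `b` is exactly
  -- what keeps `t ≤ a / 2`.
  set t := a ^ 2 * b / 256 with ht
  have ht0 : 0 ≤ t := by positivity
  have htle : t ≤ a / 2 := by
    rw [le_div_iff₀ ha0] at hb'
    rw [ht]
    nlinarith
  have hcov : ∀ A : Fin N → Fin n → ℝ, u ⬝ᵥ (sampleCov (Matrix.of A) *ᵥ v)
      = 1 / (N : ℝ) * ∑ i, (u ⬝ᵥ A i) * (v ⬝ᵥ A i) := by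
    intro A
    rw [dotProduct_sampleCov_mulVec]
    congr 1
    refine Finset.sum_congr rfl fun i _ => ?_
    congr 1
    · exact dotProduct_comm _ _
    · exact dotProduct_comm _ _
  have hsum : ∀ (s : ℝ) (A : Fin N → Fin n → ℝ),
      ∑ i, s * ((u ⬝ᵥ A i) * (v ⬝ᵥ A i) - m)
        = s * (N * (u ⬝ᵥ (sampleCov (Matrix.of A) *ᵥ v) - m)) := by
    intro s A
    rw [hcov, ← Finset.mul_sum, Finset.sum_sub_distrib]
    simp only [Finset.sum_const, Finset.card_univ, Fintype.card_fin, nsmul_eq_mul]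
    field_simp
  have htail : ∀ s : ℝ, |s| = t → Measure.pi (fun _ : Fin N => Q)
      {A | N * (t * b) ≤ ∑ i, s * ((u ⬝ᵥ A i) * (v ⬝ᵥ A i) - m)}
      ≤ ENNReal.ofReal (Real.exp (-(a ^ 2 / 512 * (N * b ^ 2)))) := by
    intro s hs
    refine (pi_le_sum_le (f := fun _ x => s * ((u ⬝ᵥ x) * (v ⬝ᵥ x) - m))
      (fun _ => by fun_prop) (fun _ => hmgf s (hs ▸ htle)) _).trans ?_
    apply ENNReal.ofReal_le_ofReal
    apply Real.exp_le_exp.2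
    have hs2 : s ^ 2 = t ^ 2 := by rw [← sq_abs, hs]
    simp only [Finset.sum_const, Finset.card_univ, Fintype.card_fin, nsmul_eq_mul, hs2]
    apply le_of_eq
    rw [ht]
    field_simp
    ring
  have hsub : {A : Fin N → Fin n → ℝ | b < |u ⬝ᵥ (sampleCov (Matrix.of A) *ᵥ v) - m|} ⊆
      {A | N * (t * b) ≤ ∑ i, t * ((u ⬝ᵥ A i) * (v ⬝ᵥ A i) - m)} ∪
      {A | N * (t * b) ≤ ∑ i, (-t) * ((u ⬝ᵥ A i) * (v ⬝ᵥ A i) - m)} := by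
    intro A hA
    simp only [Set.mem_union, Set.mem_ofPred_eq, hsum] at hA ⊢
    rcases lt_abs.1 hA with h | h
    · left
      have := mul_le_mul_of_nonneg_left h.le (mul_nonneg ht0 hN'.le)
      linarith
    · right
      have := mul_le_mul_of_nonneg_left h.le (mul_nonneg ht0 hN'.le)
      linarith
  refine (measure_mono hsub).trans ((measure_union_le _ _).trans ?_)
  rw [two_mul, ENNReal.ofReal_add (Real.exp_pos _).le (Real.exp_pos _).le]
  exact add_le_add (htail t (abs_of_nonneg ht0)) (htail (-t) (by rw [abs_neg, abs_of_nonneg ht0]))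

/-- Tail bound for a linear combination of independent centred Gaussian variables. -/
lemma gaussian_measure_lt_abs_le (τ : NNReal) (w : Fin N → ℝ) {b V : ℝ} (hb : 0 ≤ b) (hV : 0 < V)
    (hτ : (τ : ℝ) * (w ⬝ᵥ w) ≤ V) :
    Measure.pi (fun _ : Fin N => gaussianReal 0 τ) {e | b < |w ⬝ᵥ e|}
      ≤ ENNReal.ofReal (2 * Real.exp (-(b ^ 2 / (2 * V)))) := by
  have hmgf : ∀ s : ℝ, ∫⁻ x, ENNReal.ofReal (Real.exp (s * x))
      ∂(gaussianReal 0 τ) ≤ ENNReal.ofReal (Real.exp ((τ : ℝ) * s ^ 2 / 2)) := by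
    intro s
    rw [← ofReal_integral_eq_lintegral_ofReal (integrable_exp_mul_gaussianReal s)
      (ae_of_all _ fun x => (Real.exp_pos _).le)]
    apply ENNReal.ofReal_le_ofReal
    have := congrFun (mgf_fun_id_gaussianReal (μ := 0) (v := τ)) s
    rw [mgf] at this
    rw [this]
    apply le_of_eq
    congr 1
    ring
  set t := b / V with ht
  have ht0 : 0 ≤ t := by positivity
  have htail : ∀ s : ℝ, |s| = t →
      Measure.pi (fun _ : Fin N => gaussianReal 0 τ)
        {e | t * b ≤ ∑ i, s * w i * e i} ≤ ENNReal.ofReal (Real.exp (-(b ^ 2 / (2 * V)))) := by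
    intro s hs
    refine (pi_le_sum_le (f := fun i x => s * w i * x)
      (fun _ => by fun_prop) (fun i => hmgf (s * w i)) _).trans ?_
    apply ENNReal.ofReal_le_ofReal
    apply Real.exp_le_exp.2
    have hs2 : s ^ 2 = t ^ 2 := by rw [← sq_abs, hs]
    have e1 : ∑ i, (τ : ℝ) * (s * w i) ^ 2 / 2 = t ^ 2 / 2 * ((τ : ℝ) * (w ⬝ᵥ w)) := by
      rw [dotProduct, Finset.mul_sum, Finset.mul_sum]
      refine Finset.sum_congr rfl fun i _ => ?_
      rw [mul_pow, hs2]; ring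
    rw [e1]
    have := mul_le_mul_of_nonneg_left hτ (show 0 ≤ t ^ 2 / 2 by positivity)
    refine (sub_le_sub_right this _).trans (le_of_eq ?_)
    rw [ht]
    field_simp
    ring
  have hsum : ∀ (s : ℝ) (e : Fin N → ℝ), ∑ i, s * w i * e i = s * (w ⬝ᵥ e) := by
    intro s e
    simp only [dotProduct, Finset.mul_sum, mul_assoc]
  have hsub : {e : Fin N → ℝ | b < |w ⬝ᵥ e|} ⊆
      {e | t * b ≤ ∑ i, t * w i * e i} ∪ {e | t * b ≤ ∑ i, (-t) * w i * e i} := by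
    intro e he
    simp only [Set.mem_union, Set.mem_ofPred_eq, hsum] at he ⊢
    rcases lt_abs.1 he with h | h
    · left
      exact mul_le_mul_of_nonneg_left h.le ht0
    · right
      have := mul_le_mul_of_nonneg_left h.le ht0
      linarith
  refine (measure_mono hsub).trans ((measure_union_le _ _).trans ?_)
  rw [two_mul, ENNReal.ofReal_add (Real.exp_pos _).le (Real.exp_pos _).le]
  exact add_le_add (htail t (abs_of_nonneg ht0)) (htail (-t) (by rw [abs_neg, abs_of_nonneg ht0]))

end Concentration

/-! ### The conditional law of the leading term -/

section ConditionalLaw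

variable {N n : ℕ}

/-- By characteristic functions: that of `B e` at `t` is that of `e` at `Bᵀ t`, a product of
one-dimensional ones. -/
lemma map_mulVec_pi_gaussianReal (τ : NNReal) (B : Matrix (Fin n) (Fin N) ℝ) :
    (Measure.pi fun _ : Fin N => gaussianReal 0 τ).map (fun e => WithLp.toLp 2 (B *ᵥ e))
      = multivariateGaussian 0 ((τ : ℝ) • (B * Bᵀ)) := by
  have hmeas : Measurable fun e : Fin N → ℝ => WithLp.toLp 2 (B *ᵥ e) := by
    have : Measurable fun e : Fin N → ℝ => B *ᵥ e := by
      refine measurable_pi_iff.2 fun i => ?_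
      simp only [Matrix.mulVec, dotProduct]
      fun_prop
    fun_prop
  have hpsd : ((τ : ℝ) • (B * Bᵀ)).PosSemidef := by
    have := Matrix.posSemidef_self_mul_conjTranspose B
    rw [Matrix.conjTranspose_eq_transpose_of_trivial] at this
    exact this.smul τ.2
  have : IsProbabilityMeasure ((Measure.pi fun _ : Fin N => gaussianReal 0 τ).map
      (fun e => WithLp.toLp 2 (B *ᵥ e))) := Measure.isProbabilityMeasure_map hmeas.aemeasurable
  refine Measure.ext_of_charFun (E := EuclideanSpace ℝ (Fin n)) ?_
  ext t
  rw [charFun_multivariateGaussian hpsd]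
  have h1 : charFun ((Measure.pi fun _ : Fin N => gaussianReal 0 τ).map
      (fun e => WithLp.toLp 2 (B *ᵥ e))) t
      = charFun ((Measure.pi fun _ : Fin N => gaussianReal 0 τ).map (WithLp.toLp 2))
        (WithLp.toLp 2 (Bᵀ *ᵥ t.ofLp)) := by
    rw [charFun_apply, charFun_apply, integral_map hmeas.aemeasurable
      (Measurable.aestronglyMeasurable (by fun_prop)), integral_map (by fun_prop)
      (Measurable.aestronglyMeasurable (by fun_prop))]
    refine integral_congr_ae (ae_of_all _ fun e => ?_)
    have : inner ℝ (WithLp.toLp 2 (B *ᵥ e)) t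
        = inner ℝ (WithLp.toLp 2 e) (WithLp.toLp 2 (Bᵀ *ᵥ t.ofLp)) := by
      rw [EuclideanSpace.inner_eq_star_dotProduct, EuclideanSpace.inner_eq_star_dotProduct]
      simp only [star_trivial]
      rw [Matrix.dotProduct_mulVec, Matrix.mulVec_transpose]
    simp only [this]
  rw [h1, charFun_pi]
  simp only [charFun_gaussianReal]
  rw [← Complex.exp_sum]
  congr 1
  have h2 : t.ofLp ⬝ᵥ (((τ : ℝ) • (B * Bᵀ)) *ᵥ t.ofLp)
      = τ * ∑ i, (Bᵀ *ᵥ t.ofLp) i ^ 2 := by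
    rw [Matrix.smul_mulVec, dotProduct_smul, smul_eq_mul, ← Matrix.mulVec_mulVec,
      Matrix.dotProduct_mulVec, ← Matrix.mulVec_transpose]
    simp [dotProduct, sq]
  rw [h2]
  push_cast
  simp [Finset.mul_sum, Finset.sum_div, mul_comm]

lemma leadingTerm_eq_mulVec (A : Matrix (Fin N) (Fin n) ℝ) (Θ : Matrix (Fin n) (Fin n) ℝ)
    (e : Fin N → ℝ) : leadingTerm A Θ e = ((1 / √(N : ℝ)) • (Θ * Aᵀ)) *ᵥ e := by
  rw [leadingTerm, Matrix.smul_mulVec]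

lemma map_leadingTerm_pi_gaussianReal (τ : NNReal) (A : Matrix (Fin N) (Fin n) ℝ)
    (Θ : Matrix (Fin n) (Fin n) ℝ) :
    (Measure.pi fun _ : Fin N => gaussianReal 0 τ).map
        (fun e => WithLp.toLp 2 (leadingTerm A Θ e))
      = multivariateGaussian 0 ((τ : ℝ) • (Θ * sampleCov A * Θᵀ)) := by
  simp only [leadingTerm_eq_mulVec]
  rw [map_mulVec_pi_gaussianReal]
  congr 2
  rw [Matrix.transpose_smul, Matrix.smul_mul, Matrix.mul_smul, smul_smul, Matrix.transpose_mul,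
    Matrix.transpose_transpose, sampleCov, Matrix.mul_smul, Matrix.smul_mul, div_mul_div_comm,
    Real.mul_self_sqrt (Nat.cast_nonneg N), one_mul]
  simp only [Matrix.mul_assoc]

lemma measurable_leadingTerm {T : Matrix (Fin N) (Fin n) ℝ → Matrix (Fin n) (Fin n) ℝ}
    (hT : Measurable T) :
    Measurable fun p : Matrix (Fin N) (Fin n) ℝ × (Fin N → ℝ) =>
      WithLp.toLp 2 (leadingTerm p.1 (T p.1) p.2) := by
  have hT' : ∀ i j, Measurable fun p : Matrix (Fin N) (Fin n) ℝ × (Fin N → ℝ) => T p.1 i j :=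
    fun i j => (measurable_pi_iff.1 (measurable_pi_iff.1 (hT.comp measurable_fst) i) j)
  have hA : ∀ i j, Measurable fun p : Matrix (Fin N) (Fin n) ℝ × (Fin N → ℝ) => p.1 i j :=
    fun i j => (measurable_pi_iff.1 (measurable_pi_iff.1 measurable_fst i) j)
  have : Measurable fun p : Matrix (Fin N) (Fin n) ℝ × (Fin N → ℝ) =>
      leadingTerm p.1 (T p.1) p.2 := by
    refine measurable_pi_iff.2 fun i => ?_
    simp only [leadingTerm, Pi.smul_apply, Matrix.mulVec, dotProduct, Matrix.mul_apply,
      Matrix.transpose_apply, smul_eq_mul]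
    refine Measurable.const_mul (Finset.measurable_sum _ fun r _ => Measurable.mul
      (Finset.measurable_sum _ fun l _ => (hT' i l).mul (hA r l)) ?_) _
    exact (measurable_pi_apply r).comp measurable_snd
  exact (PiLp.continuous_toLp 2 _).measurable.comp this

/-- By independence, the joint law of design and leading term is the law of `X` composed with the
kernel that freezes the design and pushes the noise forward. Disintegrations are almost surely
unique, so this kernel is the conditional law. -/
lemma condDistrib_leadingTerm {Ω : Type*} [MeasurableSpace Ω] {P : Measure Ω}
    [IsProbabilityMeasure P] {X : Ω → Matrix (Fin N) (Fin n) ℝ} {ε : Ω → Fin N → ℝ} {τ : NNReal}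
    (hX : AEMeasurable X P)
    (hε : HasLaw ε (Measure.pi fun _ : Fin N => gaussianReal 0 τ) P) (hind : IndepFun X ε P)
    {T : Matrix (Fin N) (Fin n) ℝ → Matrix (Fin n) (Fin n) ℝ} (hT : Measurable T) :
    ∀ᵐ A ∂(P.map X),
      condDistrib (fun ω => WithLp.toLp 2 (leadingTerm (X ω) (T (X ω)) (ε ω))) X P A
        = multivariateGaussian 0 ((τ : ℝ) • (T A * sampleCov A * (T A)ᵀ)) := by
  set γ : Measure (Fin N → ℝ) := Measure.pi fun _ : Fin N => gaussianReal 0 τ with hγ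
  set g : Matrix (Fin N) (Fin n) ℝ × (Fin N → ℝ) → EuclideanSpace ℝ (Fin n) :=
    fun p => WithLp.toLp 2 (leadingTerm p.1 (T p.1) p.2) with hg
  have hgm : Measurable g := measurable_leadingTerm hT
  have : IsProbabilityMeasure (P.map X) := Measure.isProbabilityMeasure_map hX
  set κ : Kernel (Matrix (Fin N) (Fin n) ℝ) (EuclideanSpace ℝ (Fin n)) :=
    (Kernel.id ×ₖ Kernel.const _ γ).map g with hκ
  have hκA : ∀ A, κ A = multivariateGaussian 0 ((τ : ℝ) • (T A * sampleCov A * (T A)ᵀ)) := by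
    intro A
    rw [hκ, Kernel.map_apply _ hgm, Kernel.prod_apply, Kernel.id_apply, Kernel.const_apply,
      Measure.dirac_prod, Measure.map_map hgm (by fun_prop), ← map_leadingTerm_pi_gaussianReal]
    rfl
  have hlaw : P.map (fun ω => (X ω, ε ω)) = (P.map X).prod γ := by
    rw [(indepFun_iff_map_prod_eq_prod_map_map hX hε.aemeasurable).1 hind, hε.map_eq]
  have hpair : P.map (fun ω => (X ω, g (X ω, ε ω))) = (P.map X) ⊗ₘ κ := by
    have h1 : P.map (fun ω => (X ω, g (X ω, ε ω)))
        = ((P.map X).prod γ).map (fun p => (p.1, g p)) := by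
      rw [← hlaw, AEMeasurable.map_map_of_aemeasurable (by fun_prop)
        (hX.prodMk hε.aemeasurable)]
      rfl
    rw [h1]
    have hm : Measurable fun p : Matrix (Fin N) (Fin n) ℝ × (Fin N → ℝ) => (p.1, g p) := by
      fun_prop
    ext s hs
    rw [Measure.map_apply hm hs, Measure.prod_apply (hm hs), Measure.compProd_apply hs]
    refine lintegral_congr fun A => ?_
    rw [hκ, Kernel.map_apply _ hgm, Kernel.prod_apply, Kernel.id_apply, Kernel.const_apply,
      Measure.dirac_prod, Measure.map_map hgm (by fun_prop),
      Measure.map_apply (hgm.comp (by fun_prop)) (measurable_prodMk_left hs)]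
    rfl
  have hae := condDistrib_ae_eq_of_measure_eq_compProd (μ := P) (Y := fun ω => g (X ω, ε ω)) X
    (κ := κ) (hgm.comp_aemeasurable (hX.prodMk hε.aemeasurable)) hpair
  filter_upwards [hae] with A hA
  rw [← hκA A, ← hA]

end ConditionalLaw

/-! ### Matrices with bounded eigenvalues -/

section Spectral

variable {n : ℕ} {S : Matrix (Fin n) (Fin n) ℝ} {lo hi : ℝ}

lemma SymmEigenvaluesIn.transpose_eq (h : SymmEigenvaluesIn lo hi S) : Sᵀ = S := by
  obtain ⟨h, -⟩ := h
  simpa [Matrix.IsHermitian, Matrix.conjTranspose_eq_transpose_of_trivial] using h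

lemma SymmEigenvaluesIn.quadForm_bounds (h : SymmEigenvaluesIn lo hi S) (v : Fin n → ℝ) :
    lo * (v ⬝ᵥ v) ≤ v ⬝ᵥ (S *ᵥ v) ∧ v ⬝ᵥ (S *ᵥ v) ≤ hi * (v ⬝ᵥ v) := by
  have hsymm := h.transpose_eq
  obtain ⟨h, hb⟩ := h
  set w : Fin n → Fin n → ℝ := fun i => (h.eigenvectorBasis i).ofLp with hw
  have hparseval : ∀ x y : Fin n → ℝ, x ⬝ᵥ y = ∑ i, (w i ⬝ᵥ x) * (w i ⬝ᵥ y) := by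
    intro x y
    have := h.eigenvectorBasis.sum_inner_mul_inner (WithLp.toLp 2 x) (WithLp.toLp 2 y)
    simp only [EuclideanSpace.inner_eq_star_dotProduct, star_trivial] at this
    rw [dotProduct_comm x y, ← this]
    exact Finset.sum_congr rfl fun i _ => by rw [dotProduct_comm y]
  have hev : ∀ i, w i ⬝ᵥ (S *ᵥ v) = h.eigenvalues i * (w i ⬝ᵥ v) := by
    intro i
    rw [Matrix.dotProduct_mulVec, ← Matrix.mulVec_transpose, hsymm]
    have : S *ᵥ w i = h.eigenvalues i • w i := h.mulVec_eigenvectorBasis i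
    rw [this, smul_dotProduct, smul_eq_mul]
  rw [hparseval v v, hparseval v (S *ᵥ v), Finset.mul_sum, Finset.mul_sum]
  constructor
  · refine Finset.sum_le_sum fun i _ => ?_
    rw [hev]
    have := mul_le_mul_of_nonneg_right (hb i).1 (mul_self_nonneg (w i ⬝ᵥ v))
    linarith
  · refine Finset.sum_le_sum fun i _ => ?_
    rw [hev]
    have := mul_le_mul_of_nonneg_right (hb i).2 (mul_self_nonneg (w i ⬝ᵥ v))
    linarith

lemma SymmEigenvaluesIn.isUnit_det (h : SymmEigenvaluesIn lo hi S) (hlo : 0 < lo) :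
    IsUnit S.det := by
  rw [← Matrix.isUnit_iff_isUnit_det, ← Matrix.mulVec_injective_iff_isUnit]
  intro x y hxy
  have h0 : S *ᵥ (x - y) = 0 := by
    rw [Matrix.mulVec_sub]; exact sub_eq_zero.2 hxy
  have h1 := (h.quadForm_bounds (x - y)).1
  rw [h0, dotProduct_zero] at h1
  have h2 := dotProduct_self_nonneg' (x - y)
  have h3 : (x - y) ⬝ᵥ (x - y) = 0 := by nlinarith
  exact sub_eq_zero.1 (dotProduct_self_eq_zero.1 h3)

lemma SymmEigenvaluesIn.inv_transpose_eq (h : SymmEigenvaluesIn lo hi S) : (S⁻¹)ᵀ = S⁻¹ := by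
  rw [Matrix.transpose_nonsing_inv, h.transpose_eq]

lemma SymmEigenvaluesIn.inv_row_dotProduct (h : SymmEigenvaluesIn lo hi S) (hlo : 0 < lo)
    (i : Fin n) (v : Fin n → ℝ) : S⁻¹ i ⬝ᵥ (S *ᵥ v) = v i := by
  have : (S⁻¹ *ᵥ (S *ᵥ v)) i = v i := by
    rw [Matrix.mulVec_mulVec, Matrix.nonsing_inv_mul _ (h.isUnit_det hlo), Matrix.one_mulVec]
  exact this

/-- For `u` the `i`-th row, `lo ‖u‖² ≤ uᵀ S u = u_i ≤ ‖u‖`. The scaled row is thus admissible in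
`measure_lt_abs_le`, with constants free of the dimension. -/
lemma SymmEigenvaluesIn.inv_row_norm_le (h : SymmEigenvaluesIn lo hi S) (hlo : 0 < lo)
    (i : Fin n) : (lo • S⁻¹ i) ⬝ᵥ (lo • S⁻¹ i) ≤ 1 := by
  set u := S⁻¹ i with hu
  have h1 := (h.quadForm_bounds u).1
  rw [hu, h.inv_row_dotProduct hlo i, ← hu] at h1
  have h2 : u i ^ 2 ≤ u ⬝ᵥ u := by
    have := Finset.single_le_sum (f := fun j => u j * u j) (fun j _ => mul_self_nonneg (u j))
      (Finset.mem_univ i)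
    simpa [dotProduct, sq] using this
  rw [smul_dotProduct, dotProduct_smul, smul_eq_mul, smul_eq_mul]
  have h0 := dotProduct_self_nonneg' u
  set q := u ⬝ᵥ u
  rcases h0.eq_or_lt with hq | hq
  · rw [← hq]; simp
  · have h3 : (lo * q) ^ 2 ≤ q := by
      have : (lo * q) ^ 2 ≤ u i ^ 2 := by gcongr
      linarith
    have h4 : q * (lo * (lo * q)) ≤ q * 1 := by nlinarith
    exact le_of_mul_le_mul_left h4 hq

end Spectral

/-! ### The event on which the estimators behave well -/

section GoodEvent

variable {N n : ℕ}

lemma nat_mul_two_exp_le {x : ℝ} {n : ℕ} (hn : 2 ≤ n) {k p : ℕ} (hx : (p + 1) * Real.log n ≤ x)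
    (hk : k ≤ n ^ p) : k * (2 * Real.exp (-x)) ≤ 2 / n := by
  have hn0 : (0 : ℝ) < n := by exact_mod_cast (by omega : 0 < n)
  have h1 : Real.exp (-x) ≤ ((n : ℝ) ^ (p + 1))⁻¹ := by
    rw [Real.exp_neg]
    refine inv_anti₀ (by positivity) ?_
    calc (n : ℝ) ^ (p + 1) = Real.exp ((p + 1 : ℕ) * Real.log n) := by
          rw [Real.exp_nat_mul, Real.exp_log hn0]
      _ ≤ Real.exp x := Real.exp_le_exp.2 (by push_cast; exact hx)
  have h2 : (k : ℝ) ≤ (n : ℝ) ^ p := by exact_mod_cast hk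
  calc k * (2 * Real.exp (-x)) ≤ (n : ℝ) ^ p * (2 * ((n : ℝ) ^ (p + 1))⁻¹) := by gcongr
    _ = 2 / n := by rw [pow_succ]; field_simp

lemma measure_exists_le {α ι : Type*} [MeasurableSpace α] [Fintype ι] {μ : Measure α}
    {p : ι → α → Prop} {n k q : ℕ} {x : ℝ} (hn : 2 ≤ n) (hk : Fintype.card ι = k)
    (hkq : k ≤ n ^ q) (hx : (q + 1) * Real.log n ≤ x)
    (h : ∀ i, μ {a | p i a} ≤ ENNReal.ofReal (2 * Real.exp (-x))) :
    μ {a | ∃ i, p i a} ≤ ENNReal.ofReal (2 / n) := by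
  have : {a | ∃ i, p i a} = ⋃ i, {a | p i a} := by ext; simp
  rw [this]
  refine (measure_iUnion_fintype_le μ _).trans ((Finset.sum_le_sum fun i _ => h i).trans ?_)
  rw [Finset.sum_const, Finset.card_univ, hk, nsmul_eq_mul, ← ENNReal.ofReal_natCast,
    ← ENNReal.ofReal_mul (by positivity)]
  exact ENNReal.ofReal_le_ofReal (nat_mul_two_exp_le hn hx hkq)

section Design

variable {Q : Measure (Fin n → ℝ)} [IsProbabilityMeasure Q] {σ lo hi a : ℝ}
  {S : Matrix (Fin n) (Fin n) ℝ}

lemma measure_inv_infeasible_le (hσ : 0 < σ) (hQ : IsSubGaussianLaw σ Q)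
    (hcov : ∀ a b, cov[fun x => x a, fun x => x b; Q] = S a b) (hS : SymmEigenvaluesIn lo hi S)
    (hlo : 0 < lo) (ha : a = 1 / (6 * σ ^ 2)) (hn : 2 ≤ n) (hN : 0 < N)
    (hNn : Real.log n ≤ N) :
    Measure.pi (fun _ : Fin N => Q) {A | ∃ p : Fin n × Fin n,
      40 / (a * lo) * √(Real.log n / N) < |(S⁻¹ * sampleCov (Matrix.of A) - 1) p.1 p.2|}
      ≤ ENNReal.ofReal (2 / n) := by
  have ha0 : 0 < a := by rw [ha]; positivity
  have hN' : (0 : ℝ) < N := by exact_mod_cast hN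
  have hlog : 0 ≤ Real.log n := Real.log_natCast_nonneg n
  have hr : √(Real.log n / N) ≤ 1 := by
    rw [Real.sqrt_le_iff, one_pow, div_le_one hN']
    exact ⟨zero_le_one, hNn⟩
  -- The constant 40 gives the exponent `(1600 / 512) log n`, just above the `3 log n` needed for
  -- `n²` entries.
  refine measure_exists_le (q := 2) hn (k := n ^ 2) (by simp [sq]) le_rfl
    (x := a ^ 2 / 512 * (N * (40 / a * √(Real.log n / N)) ^ 2)) ?_ fun p => ?_
  · rw [mul_pow, Real.sq_sqrt (by positivity)]
    have : a ^ 2 / 512 * (N * ((40 / a) ^ 2 * (Real.log n / N))) = 25 / 8 * Real.log n := by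
      field_simp
      ring
    rw [this]
    push_cast
    linarith
  · refine le_trans (measure_mono ?_) (measure_lt_abs_le (u := lo • S⁻¹ p.1)
      (v := Pi.single p.2 1) hσ hQ hcov hN (hS.inv_row_norm_le hlo p.1) (by simp) ha
      (b := 40 / a * √(Real.log n / N)) (by positivity) ?_)
    · intro A hA
      rw [Set.mem_ofPred_eq] at hA ⊢
      have h1 : (lo • S⁻¹ p.1) ⬝ᵥ (sampleCov (Matrix.of A) *ᵥ Pi.single p.2 1)
          - (lo • S⁻¹ p.1) ⬝ᵥ (S *ᵥ Pi.single p.2 1)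
          = lo * (S⁻¹ * sampleCov (Matrix.of A) - 1) p.1 p.2 := by
        rw [smul_dotProduct, smul_dotProduct, hS.inv_row_dotProduct hlo, Matrix.sub_apply,
          Matrix.mulVec_single_one, Matrix.one_apply, Pi.single_apply, smul_eq_mul, smul_eq_mul,
          mul_sub]
        rfl
      rw [h1, abs_mul, abs_of_pos hlo]
      have := mul_lt_mul_of_pos_left hA hlo
      refine lt_of_eq_of_lt ?_ this
      field_simp
    · calc 40 / a * √(Real.log n / N) ≤ 40 / a * 1 := by gcongr
        _ ≤ 128 / a := by rw [mul_one]; gcongr; norm_num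

lemma measure_diag_large_le (hσ : 0 < σ) (hQ : IsSubGaussianLaw σ Q)
    (hcov : ∀ a b, cov[fun x => x a, fun x => x b; Q] = S a b) (hS : SymmEigenvaluesIn lo hi S)
    (ha : a = 1 / (6 * σ ^ 2)) (hn : 2 ≤ n) (hN : 0 < N) (hNn : Real.log n ≤ N) :
    Measure.pi (fun _ : Fin N => Q) {A | ∃ l, hi + 128 / a < sampleCov (Matrix.of A) l l}
      ≤ ENNReal.ofReal (2 / n) := by
  have ha0 : 0 < a := by rw [ha]; positivity
  have hlog : 0 ≤ Real.log n := Real.log_natCast_nonneg n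
  refine measure_exists_le (q := 1) hn (k := n) (by simp) (by simp)
    (x := a ^ 2 / 512 * (N * (128 / a) ^ 2)) ?_ fun l => ?_
  · have : a ^ 2 / 512 * (N * (128 / a) ^ 2) = 32 * N := by
      field_simp
      norm_num
    rw [this]
    push_cast
    linarith
  · refine le_trans (measure_mono ?_) (measure_lt_abs_le (u := Pi.single l 1)
      (v := Pi.single l 1) hσ hQ hcov hN (by simp) (by simp) ha (b := 128 / a) (by positivity)
      le_rfl)
    intro A hA
    rw [Set.mem_ofPred_eq] at hA ⊢
    have h1 := (hS.quadForm_bounds (Pi.single l 1)).2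
    have h2 : (Pi.single l 1 : Fin n → ℝ) ⬝ᵥ Pi.single l 1 = 1 := by simp
    have h3 : (Pi.single l 1 : Fin n → ℝ) ⬝ᵥ (sampleCov (Matrix.of A) *ᵥ Pi.single l 1)
        = sampleCov (Matrix.of A) l l := by simp
    rw [h2, mul_one] at h1
    rw [h3]
    refine lt_of_lt_of_le ?_ (le_abs_self _)
    linarith

lemma measure_quadForm_small_le (hσ : 0 < σ) (hQ : IsSubGaussianLaw σ Q)
    (hcov : ∀ a b, cov[fun x => x a, fun x => x b; Q] = S a b) (hS : SymmEigenvaluesIn lo hi S)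
    (ha : a = 1 / (6 * σ ^ 2)) (hn : 2 ≤ n) (hN : 0 < N) {b : ℝ} (hb : 0 < b) (hblo : b ≤ lo / 2)
    (hba : b ≤ 128 / a) {k : ℕ} (hk : (2 * k + 1) * Real.log n ≤ a ^ 2 / 512 * (N * b ^ 2)) :
    Measure.pi (fun _ : Fin N => Q) {A | ∃ f : Fin k → Fin n × Bool,
      signedSum f ⬝ᵥ (sampleCov (Matrix.of A) *ᵥ signedSum f)
        < lo / 2 * (signedSum f ⬝ᵥ signedSum f)} ≤ ENNReal.ofReal (2 / n) := by
  refine measure_exists_le (q := 2 * k) hn (k := (n * 2) ^ k) (by simp) ?_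
    (x := a ^ 2 / 512 * (N * b ^ 2)) (by push_cast; exact hk) fun f => ?_
  · rw [pow_mul, sq]
    exact Nat.pow_le_pow_left (Nat.mul_le_mul_left n hn) k
  set z := signedSum f with hz
  set r := √(z ⬝ᵥ z) with hr
  have hrr : r * r = z ⬝ᵥ z := Real.mul_self_sqrt (dotProduct_self_nonneg' z)
  have hr0 : 0 ≤ r := Real.sqrt_nonneg _
  -- An inequality, since a signed sum may vanish; then `r⁻¹ = 0`.
  have hunit : (r⁻¹ • z) ⬝ᵥ (r⁻¹ • z) ≤ 1 := by
    rw [smul_dotProduct, dotProduct_smul, smul_eq_mul, smul_eq_mul, ← hrr]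
    rcases hr0.eq_or_lt with h0 | h0
    · rw [← h0]; simp
    · apply le_of_eq; field_simp
  refine le_trans (measure_mono ?_) (measure_lt_abs_le (u := r⁻¹ • z)
    (v := r⁻¹ • z) hσ hQ hcov hN hunit hunit ha hb.le hba)
  intro A hA
  rw [Set.mem_ofPred_eq] at hA ⊢
  have hzne : 0 < r := by
    rcases hr0.eq_or_lt with h0 | h0
    · have : z = 0 := dotProduct_self_eq_zero.1 (by rw [← hrr, ← h0, mul_zero])
      simp [this] at hA
    · exact h0
  have hq : ∀ Γ : Matrix (Fin n) (Fin n) ℝ, (r⁻¹ • z) ⬝ᵥ (Γ *ᵥ (r⁻¹ • z))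
      = (z ⬝ᵥ (Γ *ᵥ z)) / r ^ 2 := by
    intro Γ
    rw [Matrix.mulVec_smul, smul_dotProduct, dotProduct_smul, smul_eq_mul, smul_eq_mul]
    field_simp
  rw [hq, hq, abs_sub_comm]
  refine lt_of_lt_of_le ?_ (le_abs_self _)
  rw [← sub_div, lt_div_iff₀ (by positivity)]
  have h1 := (hS.quadForm_bounds z).1
  rw [← hrr] at h1 hA
  have h2 := mul_le_mul_of_nonneg_right hblo (mul_self_nonneg r)
  rw [sq]
  linarith

end Design

lemma measurable_sampleCov_apply (i j : Fin n) :
    Measurable fun A : Fin N → Fin n → ℝ => sampleCov (Matrix.of A) i j := by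
  simp only [sampleCov, Matrix.smul_apply, Matrix.mul_apply, Matrix.transpose_apply,
    Matrix.of_apply, smul_eq_mul]
  fun_prop

lemma sum_sq_col_eq (hN : 0 < N) (A : Matrix (Fin N) (Fin n) ℝ) (l : Fin n) :
    Aᵀ l ⬝ᵥ Aᵀ l = N * sampleCov A l l := by
  have hN' : (N : ℝ) ≠ 0 := by exact_mod_cast hN.ne'
  simp only [sampleCov, Matrix.smul_apply, Matrix.mul_apply, smul_eq_mul, dotProduct,
    Matrix.transpose_apply]
  field_simp

/-- Integrate over the noise first. The diagonal bound is part of the event, so a section is either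
empty or has all squared column norms at most `N D`; the 4 in the bound on `lam` then makes the
Gaussian exponent at least `2 log n`. -/
lemma measure_noise_large_le (μ : Measure (Fin N → Fin n → ℝ)) [IsProbabilityMeasure μ]
    {τ : NNReal} {σ D lam : ℝ} (hτ : (τ : ℝ) = σ ^ 2) (hσ : 0 < σ) (hD : 0 < D) (hn : 2 ≤ n)
    (hN : 0 < N) (hlam : 4 * √D * (σ * √(Real.log n / N)) ≤ lam) :
    (μ.prod (Measure.pi fun _ : Fin N => gaussianReal 0 τ))
      {p | (∀ l, sampleCov (Matrix.of p.1) l l ≤ D) ∧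
        ∃ l, N * (lam / 2) < |((Matrix.of p.1)ᵀ *ᵥ p.2) l|} ≤ ENNReal.ofReal (2 / n) := by
  have hN' : (0 : ℝ) < N := by exact_mod_cast hN
  have hlog : 0 ≤ Real.log n := Real.log_natCast_nonneg n
  have hlam0 : 0 ≤ lam := le_trans (by positivity) hlam
  have hmeas : MeasurableSet {p : (Fin N → Fin n → ℝ) × (Fin N → ℝ) |
      (∀ l, sampleCov (Matrix.of p.1) l l ≤ D) ∧
        ∃ l, N * (lam / 2) < |((Matrix.of p.1)ᵀ *ᵥ p.2) l|} := by
    refine MeasurableSet.inter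
      (s₁ := {p : (Fin N → Fin n → ℝ) × (Fin N → ℝ) | ∀ l, sampleCov (Matrix.of p.1) l l ≤ D})
      (s₂ := {p : (Fin N → Fin n → ℝ) × (Fin N → ℝ) |
        ∃ l, N * (lam / 2) < |((Matrix.of p.1)ᵀ *ᵥ p.2) l|}) ?_ ?_
    · rw [Set.ofPred_forall]
      exact MeasurableSet.iInter fun l => measurableSet_le
        ((measurable_sampleCov_apply l l).comp measurable_fst) measurable_const
    · rw [Set.ofPred_exists]
      refine MeasurableSet.iUnion fun l => measurableSet_lt measurable_const ?_
      simp only [Matrix.mulVec, dotProduct, Matrix.transpose_apply, Matrix.of_apply]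
      fun_prop
  rw [Measure.prod_apply hmeas]
  have hpt : ∀ A : Fin N → Fin n → ℝ, (Measure.pi fun _ : Fin N => gaussianReal 0 τ)
      (Prod.mk A ⁻¹' {p : (Fin N → Fin n → ℝ) × (Fin N → ℝ) |
      (∀ l, sampleCov (Matrix.of p.1) l l ≤ D) ∧
        ∃ l, N * (lam / 2) < |((Matrix.of p.1)ᵀ *ᵥ p.2) l|}) ≤ ENNReal.ofReal (2 / n) := by
    intro A
    by_cases hA : ∀ l, sampleCov (Matrix.of A) l l ≤ D
    · refine le_trans (measure_mono (t := {e | ∃ l, N * (lam / 2)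
        < |((Matrix.of A)ᵀ *ᵥ e) l|}) fun e he => he.2) ?_
      refine measure_exists_le (q := 1) hn (k := n) (by simp) (by simp)
        (x := (N * (lam / 2)) ^ 2 / (2 * (σ ^ 2 * (N * D)))) ?_ fun l => ?_
      · rw [le_div_iff₀ (by positivity)]
        have h1 : (4 * √D * (σ * √(Real.log n / N))) ^ 2 ≤ lam ^ 2 := by gcongr
        have h2 : (4 * √D * (σ * √(Real.log n / N))) ^ 2 = 16 * D * σ ^ 2 * (Real.log n / N) := by
          rw [mul_pow, mul_pow, mul_pow, Real.sq_sqrt hD.le, Real.sq_sqrt (by positivity)]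
          ring
        rw [h2] at h1
        have h3 := mul_le_mul_of_nonneg_left h1 (show (0 : ℝ) ≤ N ^ 2 / 4 by positivity)
        have h4 : (N : ℝ) ^ 2 / 4 * (16 * D * σ ^ 2 * (Real.log n / N))
            = 4 * N * D * σ ^ 2 * Real.log n := by
          field_simp
          norm_num
        rw [h4] at h3
        push_cast
        nlinarith
      · refine gaussian_measure_lt_abs_le τ _ (by positivity) (by positivity) ?_
        rw [hτ, sum_sq_col_eq hN]
        gcongr
        exact hA l
    · have : (Prod.mk A ⁻¹' {p : (Fin N → Fin n → ℝ) × (Fin N → ℝ) |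
        (∀ l, sampleCov (Matrix.of p.1) l l ≤ D) ∧
        ∃ l, N * (lam / 2) < |((Matrix.of p.1)ᵀ *ᵥ p.2) l|}) = ∅ := by
        ext e
        simp [hA]
      rw [this, measure_empty]
      exact zero_le
  refine (lintegral_mono hpt).trans ?_
  simp

/-- The event that `S⁻¹` is feasible with tuning parameter `ρ`, the diagonal of the sample
covariance is at most `D`, its quadratic form is bounded below on sums of `k` signed coordinate
vectors, and the noise is dominated by the tuning parameter `lam`. -/
def GoodEvent (S : Matrix (Fin n) (Fin n) ℝ) (lo ρ D lam : ℝ) (k : ℕ)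
    (A : Matrix (Fin N) (Fin n) ℝ) (e : Fin N → ℝ) : Prop :=
  (∀ p : Fin n × Fin n, |(S⁻¹ * sampleCov A - 1) p.1 p.2| ≤ ρ) ∧ (∀ l, sampleCov A l l ≤ D) ∧
    (∀ f : Fin k → Fin n × Bool,
      lo / 2 * (signedSum f ⬝ᵥ signedSum f) ≤ signedSum f ⬝ᵥ (sampleCov A *ᵥ signedSum f)) ∧
    ∀ l, |(Aᵀ *ᵥ e) l| ≤ N * (lam / 2)

lemma measure_not_goodEvent_le {Ω : Type*} [MeasurableSpace Ω] {P : Measure Ω}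
    [IsProbabilityMeasure P] {X : Ω → Matrix (Fin N) (Fin n) ℝ} {ε : Ω → Fin N → ℝ} {τ : NNReal}
    {σx lo hi a b σ lam : ℝ} {S : Matrix (Fin n) (Fin n) ℝ} {k : ℕ} (hσx : 0 < σx)
    (hX : IsRowwiseSubGaussian P X σx S) (hS : SymmEigenvaluesIn lo hi S) (hlo : 0 < lo)
    (hhi : 0 < hi) (hε : HasLaw ε (Measure.pi fun _ : Fin N => gaussianReal 0 τ) P)
    (hind : IndepFun X ε P) (hτ : (τ : ℝ) = σ ^ 2) (hσ : 0 < σ)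
    (ha : a = 1 / (6 * σx ^ 2)) (hn : 2 ≤ n) (hN : 0 < N) (hNn : Real.log n ≤ N)
    (hb : 0 < b) (hblo : b ≤ lo / 2) (hba : b ≤ 128 / a)
    (hk : (2 * k + 1) * Real.log n ≤ a ^ 2 / 512 * (N * b ^ 2))
    (hlam : 4 * √(hi + 128 / a) * (σ * √(Real.log n / N)) ≤ lam) :
    P {ω | ¬ GoodEvent S lo (40 / (a * lo) * √(Real.log n / N)) (hi + 128 / a) lam k
      (X ω) (ε ω)} ≤ ENNReal.ofReal (8 / n) := by
  obtain ⟨Q, hQ, hsub, hcov, hrows, hiind⟩ := hX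
  have ha0 : 0 < a := by rw [ha]; positivity
  have hXlaw : HasLaw (X : Ω → Fin N → Fin n → ℝ) (Measure.pi fun _ : Fin N => Q) P :=
    iIndepFun.hasLaw_pi hrows hiind
  have hpair : P.map (fun ω => ((X ω : Fin N → Fin n → ℝ), ε ω))
      = (Measure.pi fun _ : Fin N => Q).prod (Measure.pi fun _ : Fin N => gaussianReal 0 τ) := by
    rw [← hXlaw.map_eq, ← hε.map_eq]
    exact (indepFun_iff_map_prod_eq_prod_map_map hXlaw.aemeasurable hε.aemeasurable).1 hind
  -- The inequality holds for arbitrary sets, so the bad events need not be shown measurable.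
  have hpre : ∀ B : Set (Fin N → Fin n → ℝ), P {ω | X ω ∈ B} ≤ Measure.pi (fun _ : Fin N => Q) B := by
    intro B
    rw [← hXlaw.map_eq]
    exact Measure.le_map_apply hXlaw.aemeasurable B
  set B₁ := {A : Fin N → Fin n → ℝ | ∃ p : Fin n × Fin n, 40 / (a * lo) * √(Real.log n / N)
    < |(S⁻¹ * sampleCov (Matrix.of A) - 1) p.1 p.2|} with hB₁
  set B₂ := {A : Fin N → Fin n → ℝ | ∃ l, hi + 128 / a < sampleCov (Matrix.of A) l l} with hB₂
  set B₃ := {A : Fin N → Fin n → ℝ | ∃ f : Fin k → Fin n × Bool,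
      signedSum f ⬝ᵥ (sampleCov (Matrix.of A) *ᵥ signedSum f)
        < lo / 2 * (signedSum f ⬝ᵥ signedSum f)} with hB₃
  set B₄ := {p : (Fin N → Fin n → ℝ) × (Fin N → ℝ) |
      (∀ l, sampleCov (Matrix.of p.1) l l ≤ hi + 128 / a) ∧
        ∃ l, N * (lam / 2) < |((Matrix.of p.1)ᵀ *ᵥ p.2) l|} with hB₄
  have h1 := (hpre B₁).trans (measure_inv_infeasible_le hσx hsub hcov hS hlo ha hn hN hNn)
  have h2 := (hpre B₂).trans (measure_diag_large_le hσx hsub hcov hS ha hn hN hNn)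
  have h3 := (hpre B₃).trans
    (measure_quadForm_small_le hσx hsub hcov hS ha hn hN hb hblo hba hk)
  have h4 : P {ω | ((X ω : Fin N → Fin n → ℝ), ε ω) ∈ B₄} ≤ ENNReal.ofReal (2 / n) := by
    refine le_trans ?_ (measure_noise_large_le (Measure.pi fun _ : Fin N => Q) hτ hσ
      (D := hi + 128 / a) (by positivity) hn hN hlam)
    rw [← hpair]
    exact Measure.le_map_apply (hXlaw.aemeasurable.prodMk hε.aemeasurable) B₄
  have hcover : {ω | ¬ GoodEvent S lo (40 / (a * lo) * √(Real.log n / N)) (hi + 128 / a) lam k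
      (X ω) (ε ω)} ⊆ (({ω | X ω ∈ B₁} ∪ {ω | X ω ∈ B₂}) ∪ {ω | X ω ∈ B₃})
        ∪ {ω | ((X ω : Fin N → Fin n → ℝ), ε ω) ∈ B₄} := by
    intro ω hω
    by_contra hcon
    simp only [Set.mem_union, not_or] at hcon
    obtain ⟨⟨⟨c1, c2⟩, c3⟩, c4⟩ := hcon
    have g2 : ∀ l, sampleCov (X ω) l l ≤ hi + 128 / a := fun l => not_lt.1 fun h => c2 ⟨l, h⟩
    exact hω ⟨fun p => not_lt.1 fun h => c1 ⟨p, h⟩, g2, fun f => not_lt.1 fun h => c3 ⟨f, h⟩,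
      fun l => not_lt.1 fun h => c4 ⟨g2, l, h⟩⟩
  have hsum : ENNReal.ofReal (8 / n) = ENNReal.ofReal (2 / n) + ENNReal.ofReal (2 / n)
      + ENNReal.ofReal (2 / n) + ENNReal.ofReal (2 / n) := by
    rw [← ENNReal.ofReal_add (by positivity) (by positivity),
      ← ENNReal.ofReal_add (by positivity) (by positivity),
      ← ENNReal.ofReal_add (by positivity) (by positivity)]
    congr 1
    ring
  rw [hsum]
  refine (measure_mono hcover).trans ((measure_union_le _ _).trans (add_le_add ?_ h4))
  refine (measure_union_le _ _).trans (add_le_add ?_ h3)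
  exact (measure_union_le _ _).trans (add_le_add h1 h2)

end GoodEvent

/-! ### Bounds on the good event and stochastic boundedness -/

section Rates

variable {N n : ℕ}

lemma GoodEvent.feasible {S : Matrix (Fin n) (Fin n) ℝ} {lo ρ D lam μ : ℝ} {k : ℕ}
    {A : Matrix (Fin N) (Fin n) ℝ} {e : Fin N → ℝ} (h : GoodEvent S lo ρ D lam k A e)
    (hρ : 0 ≤ ρ) (hρμ : ρ ≤ μ) : CLIMEFeasible μ (sampleCov A) S⁻¹ :=
  matSupNorm_le (hρ.trans hρμ) fun i j => (h.1 (i, j)).trans hρμ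

lemma GoodEvent.matSupNorm_le {S : Matrix (Fin n) (Fin n) ℝ} {lo hi ρ D lam μ M : ℝ} {k : ℕ}
    {A : Matrix (Fin N) (Fin n) ℝ} {e : Fin N → ℝ} (h : GoodEvent S lo ρ D lam k A e)
    (hρ : 0 ≤ ρ) (hρμ : ρ ≤ μ) (hS : SymmEigenvaluesIn lo hi S) (hM : opNormInf S⁻¹ ≤ M)
    {T : Matrix (Fin N) (Fin n) ℝ → Matrix (Fin n) (Fin n) ℝ} (hT : IsCLIMEEstimator μ T) :
    matSupNorm (T A * sampleCov A * (T A)ᵀ - S⁻¹) ≤ 3 * (M * μ) := by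
  have hf := h.feasible hρ hρμ
  have hM0 : 0 ≤ M := le_trans (Real.iSup_nonneg fun i =>
    Finset.sum_nonneg fun j _ => abs_nonneg _) hM
  exact (hT.2 A ⟨_, hf⟩).matSupNorm_sub_le (sampleCov_isSymm A) hS.inv_transpose_eq hf hM0 hM

lemma GoodEvent.remainderTerm_le {S : Matrix (Fin n) (Fin n) ℝ} {lo ρ D ν lam lamg μ : ℝ}
    {m k s₁ s₂ : ℕ} {A : Matrix (Fin N) (Fin n) ℝ} {e : Fin N → ℝ}
    (h : GoodEvent S lo ρ D lam (m * s₂ + 1) A e) (hρ : 0 ≤ ρ) (hρμ : ρ ≤ μ) (hlo : 0 < lo)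
    (hD : 0 < D) (hm : 144 * D ≤ lo * m) {T : Matrix (Fin N) (Fin n) ℝ → Matrix (Fin n) (Fin n) ℝ}
    (hT : IsCLIMEEstimator μ T) {G : SimpleGraph (Fin n)} (hν : 0 ≤ ν) (hlam : 0 < lam)
    (hlamg : lamg = lam * √(ν / (2 * (maxDeg G : ℝ)) ^ (k + 1)))
    (hs₁ : 0 < s₁) (hs₂ : 0 < s₂) (hνs : ν ≤ (s₂ : ℝ) / s₁) (hN : 0 < N) {β b : Fin n → ℝ}
    (hβ : β ∈ paramSpace G k s₁ s₂) (hopt : IsGPPLasso G k lam lamg A (A *ᵥ β + e) b) :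
    vecSupNorm (remainderTerm A (T A) b β) ≤ √N * (μ * (144 / lo * s₂ * lam)) := by
  have hμ : 0 ≤ μ := hρ.trans hρμ
  have hl1 := gppLasso_l1_error hν hlam (κ := lo / 4) (by positivity) hlamg hs₁ hνs hN hβ hopt
    h.2.2.2 (restricted_eigenvalue (sampleCov_isSymm A) hlo h.2.1 hD hs₂ hm h.2.2.1)
  have e1 : 36 / (lo / 4) * s₂ * lam = 144 / lo * s₂ * lam := by field_simp; norm_num
  rw [e1] at hl1
  refine (vecSupNorm_remainderTerm_le (hT.2 A ⟨_, h.feasible hρ hρμ⟩).1 b β).trans ?_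
  gcongr

/-- Exceedance is contained in the bad event, so monotonicity suffices and `Y` need not be
measurable, as is the case for the chosen minimisers `β̂`. The witness `|C| + 1` is positive
whatever the sign of `C`. -/
lemma isBigOInProb_of_bound {Ω : ℕ → Type*} [∀ j, MeasurableSpace (Ω j)]
    {P : ∀ j, Measure (Ω j)} {Y : ∀ j, Ω j → ℝ} {a : ℕ → ℝ} {n : ℕ → ℕ}
    (hn : Tendsto n atTop atTop) (good : ∀ j, Ω j → Prop) {C : ℝ} (ha : ∀ j, 0 ≤ a j)
    (hgood : ∀ j, 2 ≤ n j → P j {ω | ¬ good j ω} ≤ ENNReal.ofReal (8 / n j))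
    (hY : ∀ j, 2 ≤ n j → ∀ ω, good j ω → |Y j ω| ≤ C * a j) : IsBigOInProb P Y a := by
  intro δ hδ
  refine ⟨|C| + 1, by positivity, ?_⟩
  filter_upwards [hn.eventually_ge_atTop (max 2 ⌈8 / δ⌉₊)] with j hj
  have hj2 : 2 ≤ n j := (le_max_left _ _).trans hj
  have hjδ : 8 / δ ≤ n j := (Nat.le_ceil _).trans (by exact_mod_cast (le_max_right _ _).trans hj)
  have hn0 : (0 : ℝ) < n j := by exact_mod_cast (by omega : 0 < n j)
  refine (measure_mono ?_).trans ((hgood j hj2).trans (ENNReal.ofReal_le_ofReal ?_))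
  · intro ω hω hg
    rw [Set.mem_ofPred_eq] at hω
    have h1 := hY j hj2 ω hg
    have h2 := mul_le_mul_of_nonneg_right (le_abs_self C) (ha j)
    have h3 := ha j
    linarith
  · rw [div_le_iff₀ hδ] at hjδ
    rw [div_le_iff₀ hn0]
    linarith

lemma remainder_rate_eq {N L s σ lo Bl Bm : ℝ} (hN : 0 < N) (hL : 0 ≤ L) :
    √N * (Bm * √(L / N) * (144 / lo * s * (Bl * (σ * √(L / N)))))
      = 144 / lo * Bm * Bl * (σ * s * L / √N) := by
  have h1 : √(L / N) * √(L / N) = L / N := Real.mul_self_sqrt (by positivity)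
  have h2 : √N * √N = N := Real.mul_self_sqrt hN.le
  have h3 : 0 < √N := Real.sqrt_pos.2 hN
  calc √N * (Bm * √(L / N) * (144 / lo * s * (Bl * (σ * √(L / N)))))
      = 144 / lo * Bm * Bl * (σ * s) * (√N * (√(L / N) * √(L / N))) := by ring
    _ = 144 / lo * Bm * Bl * (σ * s) * (L / √N) := by
        rw [h1]
        congr 1
        nth_rewrite 2 [← h2]
        field_simp
    _ = _ := by ring

end Rates

end GraphPPLasso

/-! ### Choice of the constants and assembly -/

theorem theorem6
    (k : ℕ) (ν σx cLo cHi : ℝ) (hν0 : 0 ≤ ν) (hν1 : ν < 1) (hσx : 0 < σx)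
    (hcLo : 0 < cLo) (hcHi : 0 < cHi) :
    -- thresholds depending only on `k`, `ν`, `σx` and the eigenvalue bounds
    ∃ C₀ Alam Amu : ℝ, 0 < C₀ ∧ 0 < Alam ∧ 0 < Amu ∧
      ∀ (Blam Bmu : ℝ) (N n s₁ s₂ : ℕ → ℕ) (G : ∀ j, SimpleGraph (Fin (n j)))
        (Ω : ℕ → Type*) [∀ j, MeasurableSpace (Ω j)] (P : ∀ j, Measure (Ω j))
        [∀ j, IsProbabilityMeasure (P j)]
        (S : ∀ j, Matrix (Fin (n j)) (Fin (n j)) ℝ) (M σ lam lamg mu : ℕ → ℝ)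
        (βstar : ∀ j, Fin (n j) → ℝ)
        (X : ∀ j, Ω j → Matrix (Fin (N j)) (Fin (n j)) ℝ)
        (ε y : ∀ j, Ω j → Fin (N j) → ℝ)
        (βhat : ∀ j, Ω j → Fin (n j) → ℝ)
        (T : ∀ j, Matrix (Fin (N j)) (Fin (n j)) ℝ → Matrix (Fin (n j)) (Fin (n j)) ℝ),
        -- asymptotic regime
        Tendsto n atTop atTop →
        (∀ j, C₀ * (s₂ j * Real.log (n j)) ≤ N j) →
        -- true parameter
        (∀ j, 0 < s₁ j ∧ 0 < s₂ j ∧ ν ≤ (s₂ j : ℝ) / s₁ j) →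
        (∀ j, βstar j ∈ GraphPPLasso.paramSpace (G j) k (s₁ j) (s₂ j)) →
        -- sub-Gaussian design
        (∀ j, GraphPPLasso.IsRowwiseSubGaussian (P j) (X j) σx (S j)) →
        (∀ j, GraphPPLasso.SymmEigenvaluesIn cLo cHi (S j)) →
        (∀ j, GraphPPLasso.opNormInf (S j)⁻¹ ≤ M j) →
        -- Gaussian noise independent of the design, and the linear model
        (∀ j, 0 < σ j) →
        (∀ j, HasLaw (ε j)
          (Measure.pi fun _ : Fin (N j) => gaussianReal 0 ⟨σ j ^ 2, sq_nonneg (σ j)⟩) (P j)) →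
        (∀ j, IndepFun (X j) (ε j) (P j)) →
        (∀ j ω, y j ω = X j ω *ᵥ βstar j + ε j ω) →
        -- tuning parameters
        (∀ j, Alam * (σ j * √(Real.log (n j) / N j)) ≤ lam j ∧
          lam j ≤ Blam * (σ j * √(Real.log (n j) / N j))) →
        (∀ j, lamg j = lam j * √(ν / (2 * (GraphPPLasso.maxDeg (G j) : ℝ)) ^ (k + 1))) →
        (∀ j, Amu * √(Real.log (n j) / N j) ≤ mu j ∧
          mu j ≤ Bmu * √(Real.log (n j) / N j)) →
        -- the estimators
        (∀ j ω, GraphPPLasso.IsGPPLasso (G j) k (lam j) (lamg j) (X j ω) (y j ω) (βhat j ω)) →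
        (∀ j, GraphPPLasso.IsCLIMEEstimator (mu j) (T j)) →
        -- the decomposition of the one-step estimator
        (∀ j ω, √(N j : ℝ) •
            (GraphPPLasso.oneStep (X j ω) (y j ω) (T j (X j ω)) (βhat j ω) - βstar j)
          = GraphPPLasso.leadingTerm (X j ω) (T j (X j ω)) (ε j ω)
            - GraphPPLasso.remainderTerm (X j ω) (T j (X j ω)) (βhat j ω) (βstar j)) ∧
        -- the conditional law of the leading term given the design
        (∀ j, ∀ᵐ A ∂((P j).map (X j)),
          condDistrib
              (fun ω => WithLp.toLp 2
                (GraphPPLasso.leadingTerm (X j ω) (T j (X j ω)) (ε j ω)))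
              (X j) (P j) A
            = multivariateGaussian 0
                (σ j ^ 2 • (T j A * GraphPPLasso.sampleCov A * (T j A)ᵀ))) ∧
        -- the remainder
        GraphPPLasso.IsBigOInProb P
          (fun j ω => GraphPPLasso.vecSupNorm
            (GraphPPLasso.remainderTerm (X j ω) (T j (X j ω)) (βhat j ω) (βstar j)))
          (fun j => σ j * s₂ j * Real.log (n j) / √(N j : ℝ)) ∧
        -- the asymptotic covariance
        GraphPPLasso.IsBigOInProb P
          (fun j ω => GraphPPLasso.matSupNorm
            (T j (X j ω) * GraphPPLasso.sampleCov (X j ω) * (T j (X j ω))ᵀ - (S j)⁻¹))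
          (fun j => M j * √(Real.log (n j) / N j)) := by
  set a : ℝ := 1 / (6 * σx ^ 2) with ha
  have ha0 : 0 < a := by positivity
  set D : ℝ := cHi + 128 / a with hD
  have hD0 : 0 < D := by positivity
  -- Maurey's length is `m * s₂ + 1`; this `m` meets the requirement of `restricted_eigenvalue`.
  set m : ℕ := ⌈144 * D / cLo⌉₊ with hm
  have hmD : 144 * D ≤ cLo * m := by
    have := Nat.le_ceil (144 * D / cLo)
    rw [div_le_iff₀ hcLo] at this
    linarith
  -- The deviation allowed on signed sums: small enough to leave half of the smallest eigenvalue and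
  -- to stay in the Bernstein range.
  set b : ℝ := min (cLo / 2) (128 / a) with hb
  have hb0 : 0 < b := lt_min (by positivity) (by positivity)
  set w : ℝ := a ^ 2 / 512 * b ^ 2 with hw
  have hw0 : 0 < w := by positivity
  -- In `C₀`, the summand 1 yields `log n ≤ N` and the fraction pays for the union bound over signed
  -- sums, using `s₂ ≥ 1`. The second constant lets `λ` dominate the noise; the third makes `Σ_x⁻¹`
  -- feasible.
  refine ⟨1 + (2 * (m + 1) + 1) / w, 4 * √D, 40 / (a * cLo), by positivity, by positivity,
    by positivity, ?_⟩
  intro Blam Bmu N n s₁ s₂ G Ω _ P _ S M σ lam lamg mu βstar X ε y βhat T hn hN hs hβ hX hS hM hσ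
    hε hind hy hlam hlamg hmu hopt hT
  set τ : ℕ → NNReal := fun j => ⟨σ j ^ 2, sq_nonneg (σ j)⟩ with hτ
  have hlog : ∀ j, 0 ≤ Real.log (n j) := fun j => Real.log_natCast_nonneg _
  have hlogpos : ∀ j, 2 ≤ n j → 0 < Real.log (n j) := fun j hj =>
    Real.log_pos (by exact_mod_cast hj)
  have hs1 : ∀ j, (1 : ℝ) ≤ s₂ j := fun j => by exact_mod_cast (hs j).2.1
  have hNs : ∀ j, s₂ j * Real.log (n j) ≤ N j := fun j => by
    refine le_trans ?_ (hN j)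
    have h1 : 0 ≤ s₂ j * Real.log (n j) := mul_nonneg (by positivity) (hlog j)
    have h2 : 0 ≤ (2 * (m + 1) + 1) / w * (s₂ j * Real.log (n j)) := by positivity
    linarith
  have hNn : ∀ j, Real.log (n j) ≤ N j := fun j =>
    (le_mul_of_one_le_left (hlog j) (hs1 j)).trans (hNs j)
  have hNpos : ∀ j, 2 ≤ n j → 0 < N j := fun j hj => by
    have := (hlogpos j hj).trans_le (hNn j)
    exact_mod_cast this
  have hk : ∀ j, (2 * ((m * s₂ j + 1 : ℕ) : ℝ) + 1) * Real.log (n j)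
      ≤ a ^ 2 / 512 * (N j * b ^ 2) := fun j => by
    have h1 : 2 * ((m * s₂ j + 1 : ℕ) : ℝ) + 1 ≤ (2 * (m + 1) + 1) * s₂ j := by
      push_cast
      nlinarith [hs1 j]
    have h2 : (2 * (m + 1) + 1) / w * (s₂ j * Real.log (n j)) ≤ N j := by
      refine le_trans ?_ (hN j)
      have : 0 ≤ s₂ j * Real.log (n j) := mul_nonneg (by positivity) (hlog j)
      linarith
    rw [div_mul_eq_mul_div, div_le_iff₀ hw0] at h2
    calc (2 * ((m * s₂ j + 1 : ℕ) : ℝ) + 1) * Real.log (n j)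
        ≤ (2 * (m + 1) + 1) * s₂ j * Real.log (n j) := mul_le_mul_of_nonneg_right h1 (hlog j)
      _ ≤ N j * w := by linarith
      _ = _ := by rw [hw]; ring
  have hgood : ∀ j, 2 ≤ n j → P j {ω | ¬ GraphPPLasso.GoodEvent (S j) cLo
      (40 / (a * cLo) * √(Real.log (n j) / N j)) D (lam j) (m * s₂ j + 1) (X j ω) (ε j ω)}
      ≤ ENNReal.ofReal (8 / n j) := fun j hj =>
    GraphPPLasso.measure_not_goodEvent_le (τ := τ j) hσx (hX j) (hS j) hcLo hcHi (hε j) (hind j)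
      rfl (hσ j) ha hj (hNpos j hj) (hNn j) hb0 (min_le_left _ _) (min_le_right _ _) (hk j)
      (hlam j).1
  have hXm : ∀ j, AEMeasurable (X j) (P j) := fun j => by
    obtain ⟨Q, -, -, -, hrows, -⟩ := hX j
    exact aemeasurable_pi_iff.2 fun i => (hrows i).aemeasurable
  refine ⟨fun j ω => ?_, fun j => ?_, ?_, ?_⟩
  · rw [hy]
    exact GraphPPLasso.oneStep_sub_eq _ _ _ _ _
  · exact GraphPPLasso.condDistrib_leadingTerm (τ := τ j) (hXm j) (hε j) (hind j) (hT j).1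
  · refine GraphPPLasso.isBigOInProb_of_bound hn _ (C := 144 / cLo * Bmu * Blam)
      (fun j => ?_) hgood fun j hj ω hg => ?_
    · have := (hσ j).le
      have := hlog j
      positivity
    · have hN0 : (0 : ℝ) < N j := by exact_mod_cast hNpos j hj
      have hr : 0 < √(Real.log (n j) / N j) := Real.sqrt_pos.2 (div_pos (hlogpos j hj) hN0)
      have hσj := hσ j
      have hlam0 : 0 < lam j := lt_of_lt_of_le (by positivity) (hlam j).1
      have hmu0 : 0 < mu j := lt_of_lt_of_le (by positivity) (hmu j).1
      have hopt' := hopt j ω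
      rw [hy] at hopt'
      rw [abs_of_nonneg (GraphPPLasso.vecSupNorm_nonneg _)]
      refine (hg.remainderTerm_le (by positivity) (hmu j).1 hcLo hD0 hmD (hT j) hν0 hlam0
        (hlamg j) (hs j).1 (hs j).2.1 (hs j).2.2 (hNpos j hj) (hβ j) hopt').trans ?_
      rw [← GraphPPLasso.remainder_rate_eq hN0 (hlog j)]
      have h1 := (hlam j).2
      have h2 := (hmu j).2
      gcongr
      exact hmu0.le.trans h2
  · have hM0 : ∀ j, 0 ≤ M j := fun j => le_trans (Real.iSup_nonneg fun i =>
      Finset.sum_nonneg fun l _ => abs_nonneg _) (hM j)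
    refine GraphPPLasso.isBigOInProb_of_bound hn _ (C := 3 * Bmu)
      (fun j => mul_nonneg (hM0 j) (Real.sqrt_nonneg _)) hgood fun j hj ω hg => ?_
    rw [abs_of_nonneg (GraphPPLasso.matSupNorm_nonneg _)]
    refine (hg.matSupNorm_le (by positivity) (hmu j).1 (hS j) (hM j) (hT j)).trans ?_
    have := mul_le_mul_of_nonneg_left (hmu j).2 (hM0 j)
    linarith
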